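/- **Theorem 2.1 (Moments of randomly switching PDE).** *Setting.* Let $U\subset\mathbb{R}^d$ be open and $I$ a finite set. For $i\in I$ let $b_i:\bar U\to\mathbb{R}^d$, $\sigma_i:\bar U\to\mathbb{R}^{d\times d}$, $s_i:\bar U\to\mathbb{R}$ be functions and $$\mathcal{L}_i f(x)=\sum_{j}(b_i)_j(x)\,\partial_{x_j}f(x)+\tfrac12\sum_{l,j}(\sigma_i\sigma_i^T)_{l,j}(x)\,\partial_{x_l}\partial_{x_j}f(x)+s_i(x)f(x).$$ For each $i\in I$ let $\partial U$ be the disjoint union of $\Gamma_i^{Dir},\Gamma_i^{Neu},\Gamma_i^{Rob}$, and let $g_i^{Dir}:\Gamma_i^{Dir}\to\mathbb{R}$, $g_i^{Neu}:\Gamma_i^{Neu}\to\mathbb{R}$, $g_i^{Rob},h_i^{Rob}:\Gamma_i^{Rob}\to\mathbb{R}$ and $f_i^{Rob}:\Gamma_i^{Rob}\to\partial U$ be given. Assume that at every point $x$ of $\Gamma_i^{Neu}\cup\Gamma_i^{Rob}$, $i\in I$, the set $U$ has an outward unit normal $\mathbf{n}(x)$: $|\mathbf n(x)|=1$ and, for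 every $c>0$, all $y$ close enough to $x$ satisfy: $y\in U$ if $(y-x)\cdot \mathbf n(x)<-c|y-x|$, and $y\notin U$ if $(y-x)\cdot \mathbf n(x)>c|y-x|$. Write $\partial_{\mathbf n}f(x)$ for the one-sided derivative from the left at $r=0$ of $r\mapsto f(x+r\,\mathbf n(x))$. Let $J=\{J(t)\}_{t\ge0}$ be a continuous-time Markov jump process on $I$ (a.s. with right-continuous step paths having left limits) with generator $Q=(q_{ij})$, where $q_{ij}\ge0$ for $i\ne j$ and the rows of $Q$ sum to zero. Let $\{u(x,t)\}_{t\ge0}$ be a process with values in $L^2(U)$, adapted to $J$ (up to null sets), such that: 1. For each $t>0$, almost surely $u(\cdot,t)\in C^2(\bar U)$, i.e. $u(\cdot,t)$ is $C^2$ in $U$ and its derivatives of order at most $2$ extend continuously to $\bar U$; for $t>0$, $u(\cdot,t)$ denotes this representative on $\bar U$. 2. For each $x\in U$, almost surely $u(x,\cdot)\in C((0,\infty))$. 3. For each $x\in U$, almost surely, $\partial_t u(x,t)=\mathcal{L}_{J(t)}u(x,t)$ for all $t>0$ that are not jump times of $J$. 4. For each $t>0$, almost surely, $u(x,t)=g^{Dir}_{J(t)}(x)$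 for $x\in\Gamma^{Dir}_{J(t)}$, $\ \partial_{\mathbf n}u(x,t)=g^{Neu}_{J(t)}(x)$ for $x\in\Gamma^{Neu}_{J(t)}$, and $u(f^{Rob}_{J(t)}(x),t)+h^{Rob}_{J(t)}(x)\,\partial_{\mathbf n}u(x,t)=g^{Rob}_{J(t)}(x)$ for $x\in\Gamma^{Rob}_{J(t)}$. 5. There is a deterministic $C:U\times(0,\infty)\to\mathbb{R}$, bounded on compact subsets, such that for all $x\in U$, $t>0$, $i\in I$, almost surely $$\sum_{j}\big(|(b_i)_j(x)|+1\big)|\partial_{x_j}u(x,t)|+\sum_{l,j}\big(|(\sigma_i\sigma_i^T)_{l,j}(x)|+1\big)|\partial_{x_l}\partial_{x_j}u(x,t)|+\big(|s_i(x)|+1\big)|u(x,t)|\le C(x,t).$$ 6. For each $t>0$ and $i\in I$ there are a random variable $C_2>0$ with finite expectation and a neighborhood $B$ of $\Gamma_i^{Neu}\cup\Gamma_i^{Rob}$ such that for all $j\in\{1,\dots,d\}$ and $x\in B\cap U$, almost surely $|\partial_{x_j}u(x,t)|\,1_{J(t)=i}\le C_2$. For $M\ge1$, $i\in I$ and $t>0$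 put $$v_i^M(x_1,\dots,x_M,t)=\mathbb{E}\Big[1_{J(t)=i}\prod_{m=1}^M u(x_m,t)\Big],\qquad v_i^0(t)=\mathbb{P}(J(t)=i).$$ *Conclusion.* Let $M\ge1$, $i\in I$, $t>0$. (a) If $x_1,\dots,x_M\in U$, then the expectation defining $v_i^M(x_1,\dots,x_M,t)$ exists, $v_i^M$ is $C^2$ in each of its spatial variables in $U$ and differentiable in $t$, and $$\partial_t v_i^M=\Big(\sum_{m=1}^M\mathcal{L}_i^m\Big)v_i^M+\sum_{j\in I}q_{ji}\,v_j^M,$$ where $\mathcal{L}_i^m$ is $\mathcal{L}_i$ acting on the $m$-th spatial variable. (b) Let $x_m\in\partial U$ and $x_k\in U$ for $k\ne m$. Write $\hat v_i^{M-1}=v_i^{M-1}(x_1,\dots,x_{m-1},x_{m+1},\dots,x_M,t)$ and let $\partial_{\mathbf n_m}$ be the normal derivative in the $m$-th spatial variable. Then all expectations and normal derivatives below exist, and $$v_i^M(x_1,\dots,x_M,t)=g_i^{Dir}(x_m)\,\hat v_i^{M-1}\quad\text{if }x_m\in\Gamma_i^{Dir},$$ $$\partial_{\mathbf n_m}v_i^M(x_1,\dots,x_M,t)=g_i^{Neu}(x_m)\,\hat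 v_i^{M-1}\quad\text{if }x_m\in\Gamma_i^{Neu},$$ $$v_i^M(x_1,\dots,x_{m-1},f_i^{Rob}(x_m),x_{m+1},\dots,x_M,t)+h_i^{Rob}(x_m)\,\partial_{\mathbf n_m}v_i^M(x_1,\dots,x_M,t)=g_i^{Rob}(x_m)\,\hat v_i^{M-1}\quad\text{if }x_m\in\Gamma_i^{Rob}.$$ -/

import Mathlib

open MeasureTheory Set Filter Topology

namespace SwitchingPDE

/-- Euclidean space `ℝ^d`. -/
abbrev E (d : ℕ) : Type := EuclideanSpace ℝ (Fin d)

/-! ### The continuous-time Markov jump process -/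

/-- `Q` is the generator of a jump process on a finite set: the off-diagonal entries (the jump
rates) are nonnegative and the rows sum to zero. -/
def IsGenerator {I : Type*} [Fintype I] (Q : Matrix I I ℝ) : Prop :=
  (∀ i j, i ≠ j → 0 ≤ Q i j) ∧ ∀ i, ∑ j, Q i j = 0

/-- The σ-algebra generated by `J s`, `0 ≤ s ≤ t`, where the finite state space carries its
discrete σ-algebra. -/
abbrev past {Ω I : Type*} (J : ℝ → Ω → I) (t : ℝ) : MeasurableSpace Ω :=
  ⨆ s ∈ Icc (0 : ℝ) t, MeasurableSpace.comap (J s) ⊤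

/-- `t` is not a jump time of the path `J · ω`: the path is constant near `t`. -/
def NoJumpAt {Ω I : Type*} (J : ℝ → Ω → I) (t : ℝ) (ω : Ω) : Prop :=
  ∀ᶠ s in 𝓝 t, J s ω = J t ω

/-- `(J t)_{t ≥ 0}` is a continuous-time Markov jump process with generator `Q`: its paths are
almost surely right-continuous step functions with left limits, and it is Markov with transition
matrices `exp ((t - s) Q)`. Only times `t ≥ 0` matter. -/
structure IsMarkovJumpProcess {Ω I : Type*} [MeasurableSpace Ω] [Fintype I] [DecidableEq I]
    (μ : Measure Ω) (Q : Matrix I I ℝ) (J : ℝ → Ω → I) : Prop where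
  generator : IsGenerator Q
  measurable : ∀ t, 0 ≤ t → ∀ i, MeasurableSet {ω | J t ω = i}
  right_continuous : ∀ᵐ ω ∂μ, ∀ t, 0 ≤ t → ∀ᶠ s in 𝓝[>] t, J s ω = J t ω
  left_limits : ∀ᵐ ω ∂μ, ∀ t, 0 < t → ∃ i, ∀ᶠ s in 𝓝[<] t, J s ω = i
  markov : ∀ s t, 0 ≤ s → s ≤ t → ∀ i j, ∀ A : Set Ω, MeasurableSet[past J s] A →
    μ.real (A ∩ {ω | J s ω = i} ∩ {ω | J t ω = j}) =
      μ.real (A ∩ {ω | J s ω = i}) * NormedSpace.exp ((t - s) • Q) i j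

/-! ### Differential operators and boundary derivatives -/

/-- The partial derivative `∂_{x_j} f (x)`. -/
noncomputable def pd {d : ℕ} (j : Fin d) (f : E d → ℝ) (x : E d) : ℝ :=
  fderiv ℝ f x (EuclideanSpace.single j 1)

/-- `f ∈ C²(Ū)`: `f` is `C²` in the open set `U`, and `f` and its partial derivatives of order
one and two extend continuously to the closure (the values of `f` on the boundary are those of
its continuous extension). -/
def IsC2Closure {d : ℕ} (U : Set (E d)) (f : E d → ℝ) : Prop :=
  ContDiffOn ℝ 2 f U ∧ ContinuousOn f (closure U) ∧
  (∀ j, ∃ g : E d → ℝ, ContinuousOn g (closure U) ∧ EqOn (pd j f) g U) ∧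
  (∀ l j, ∃ g : E d → ℝ, ContinuousOn g (closure U) ∧ EqOn (pd l (pd j f)) g U)

/-- `n` is the outward unit normal to `U` at the boundary point `x`: to first order at `x`, the
set `U` is the half-space `{y | ⟪y - x, n⟫ < 0}`. At every boundary point of a `C¹` domain
this is the usual outward unit normal. -/
def IsOutwardUnitNormal {d : ℕ} (U : Set (E d)) (x n : E d) : Prop :=
  ‖n‖ = 1 ∧ ∀ c : ℝ, 0 < c → ∀ᶠ y in 𝓝 x,
    (inner ℝ (y - x) n < -(c * ‖y - x‖) → y ∈ U) ∧
    (c * ‖y - x‖ < inner ℝ (y - x) n → y ∉ U)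

/-- `f` has normal derivative `D` at the boundary point `x` with outward unit normal `n`: the
one-sided derivative at `x` of `f` along the normal line, taken from inside the domain. For
`f ∈ C²(Ū)` it always exists, and is the scalar product of `n` with the continuous extension of
the gradient. -/
def HasNormalDeriv {d : ℕ} (f : E d → ℝ) (x n : E d) (D : ℝ) : Prop :=
  HasDerivWithinAt (fun r : ℝ => f (x + r • n)) D (Iic 0) 0

/-- The deterministic data of the switching boundary value problem: the domain, the coefficients
of the operators, the boundary pieces and the boundary functions. All functions are total;
only their values on the indicated sets (closure of `U`, respectively boundary pieces) matter. -/
structure Data (I : Type*) (d : ℕ) where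
  U : Set (E d)
  isOpen_U : IsOpen U
  b : I → E d → E d
  σ : I → E d → Matrix (Fin d) (Fin d) ℝ
  s : I → E d → ℝ
  ΓDir : I → Set (E d)
  ΓNeu : I → Set (E d)
  ΓRob : I → Set (E d)
  boundary_eq : ∀ i, ΓDir i ∪ ΓNeu i ∪ ΓRob i = frontier U
  disjoint_Dir_Neu : ∀ i, Disjoint (ΓDir i) (ΓNeu i)
  disjoint_Dir_Rob : ∀ i, Disjoint (ΓDir i) (ΓRob i)
  disjoint_Neu_Rob : ∀ i, Disjoint (ΓNeu i) (ΓRob i)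
  gDir : I → E d → ℝ
  gNeu : I → E d → ℝ
  gRob : I → E d → ℝ
  hRob : I → E d → ℝ
  fRob : I → E d → E d
  fRob_mapsTo : ∀ i, MapsTo (fRob i) (ΓRob i) (frontier U)
  /-- The outward unit normal, which exists wherever a normal derivative is prescribed. -/
  n : E d → E d
  isNormal : ∀ i, ∀ x ∈ ΓNeu i ∪ ΓRob i, IsOutwardUnitNormal U x (n x)

/-- The operator `L_i f = ∑ (b_i)_j ∂_j f + ½ ∑ (σ_i σ_iᵀ)_{lj} ∂_l ∂_j f + s_i f`. -/
noncomputable def Data.L {I : Type*} {d : ℕ} (P : Data I d) (i : I) (f : E d → ℝ) (x : E d) : ℝ :=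
  ∑ j, P.b i x j * pd j f x
    + (1 / 2) * ∑ l, ∑ j, (P.σ i x * (P.σ i x).transpose) l j * pd l (pd j f) x
    + P.s i x * f x

/-! ### The randomly switching PDE -/

/-- `u x t` is an `L²(U)`-valued process adapted to `J` that solves the randomly switching PDE
under the standing regularity assumptions. For `t > 0`, `u · t ω` is the representative in
`C²(Ū)`. -/
structure IsSolution {Ω I : Type*} [MeasurableSpace Ω] {d : ℕ} (μ : Measure Ω)
    (P : Data I d) (J : ℝ → Ω → I) (u : E d → ℝ → Ω → ℝ) : Prop where
  /-- The process takes values in `L²(U)`. -/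
  memLp : ∀ t, 0 ≤ t → ∀ᵐ ω ∂μ, MemLp (fun x => u x t ω) 2 (volume.restrict P.U)
  /-- Adaptedness: up to null sets, `u x t` is a function of the past of `J` at time `t`. -/
  adapted : ∀ t, 0 ≤ t → ∀ x ∈ closure P.U, AEStronglyMeasurable[past J t] (u x t) μ
  /-- Regularity in space. -/
  contDiff_space : ∀ t, 0 < t → ∀ᵐ ω ∂μ, IsC2Closure P.U (fun x => u x t ω)
  /-- Continuity in time. -/
  continuous_time : ∀ x ∈ P.U, ∀ᵐ ω ∂μ, ContinuousOn (fun t => u x t ω) (Ioi 0)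
  /-- The equation holds, almost surely, at all times between the jumps of `J`. -/
  pde : ∀ x ∈ P.U, ∀ᵐ ω ∂μ, ∀ t, 0 < t → NoJumpAt J t ω →
    HasDerivAt (fun τ => u x τ ω) (P.L (J t ω) (fun y => u y t ω) x) t
  /-- Dirichlet conditions. -/
  dirichlet : ∀ t, 0 < t → ∀ᵐ ω ∂μ, ∀ x ∈ P.ΓDir (J t ω), u x t ω = P.gDir (J t ω) x
  /-- Neumann conditions. -/
  neumann : ∀ t, 0 < t → ∀ᵐ ω ∂μ, ∀ x ∈ P.ΓNeu (J t ω),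
    HasNormalDeriv (fun y => u y t ω) x (P.n x) (P.gNeu (J t ω) x)
  /-- (Possibly non-local) Robin conditions. -/
  robin : ∀ t, 0 < t → ∀ᵐ ω ∂μ, ∀ x ∈ P.ΓRob (J t ω), ∃ D,
    HasNormalDeriv (fun y => u y t ω) x (P.n x) D ∧
    u (P.fRob (J t ω) x) t ω + P.hRob (J t ω) x * D = P.gRob (J t ω) x
  /-- Deterministic bound in the interior, bounded on compact subsets of `U × (0, ∞)`. -/
  interior_bound : ∃ C : E d × ℝ → ℝ,
    (∀ K, K ⊆ P.U ×ˢ Ioi (0 : ℝ) → IsCompact K → Bornology.IsBounded (C '' K)) ∧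
    ∀ x ∈ P.U, ∀ t, 0 < t → ∀ i, ∀ᵐ ω ∂μ,
      ∑ j, (|P.b i x j| + 1) * |pd j (fun y => u y t ω) x|
      + ∑ l, ∑ j, (|(P.σ i x * (P.σ i x).transpose) l j| + 1)
          * |pd l (pd j (fun y => u y t ω)) x|
      + (|P.s i x| + 1) * |u x t ω| ≤ C (x, t)
  /-- Integrable bound of the gradient near the Neumann and Robin parts of the boundary. -/
  boundary_bound : ∀ t, 0 < t → ∀ i, ∃ C₂ : Ω → ℝ, ∃ B : Set (E d),
    (∀ ω, 0 < C₂ ω) ∧ Integrable C₂ μ ∧ B ∈ 𝓝ˢ (P.ΓNeu i ∪ P.ΓRob i) ∧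
    ∀ j, ∀ x ∈ B ∩ P.U, ∀ᵐ ω ∂μ, J t ω = i → |pd j (fun y => u y t ω) x| ≤ C₂ ω

/-! ### The moment functions -/

/-- The random variable `1_{J(t) = i} ∏_m u(x_m, t)`. -/
noncomputable def momentVar {Ω I : Type*} {d : ℕ} (J : ℝ → Ω → I) (u : E d → ℝ → Ω → ℝ)
    {M : ℕ} (i : I) (x : Fin M → E d) (t : ℝ) : Ω → ℝ :=
  Set.indicator {ω | J t ω = i} (fun ω => ∏ m, u (x m) t ω)

/-- The moment function `v_i^M(x_1, …, x_M, t) = 𝔼[1_{J(t) = i} ∏_m u(x_m, t)]`. -/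
noncomputable def v {Ω I : Type*} [MeasurableSpace Ω] {d : ℕ} (μ : Measure Ω)
    (J : ℝ → Ω → I) (u : E d → ℝ → Ω → ℝ) {M : ℕ} (i : I) (x : Fin M → E d) (t : ℝ) : ℝ :=
  ∫ ω, momentVar J u i x t ω ∂μ

/-- The moment function of order zero is `ℙ(J(t) = i)`. -/
theorem v_zero {Ω I : Type*} [MeasurableSpace Ω] {d : ℕ} (μ : Measure Ω)
    (J : ℝ → Ω → I) (u : E d → ℝ → Ω → ℝ) (i : I) (x : Fin 0 → E d) (t : ℝ)
    (h : MeasurableSet {ω | J t ω = i}) : v μ J u i x t = μ.real {ω | J t ω = i} := by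
  unfold v momentVar
  simp only [Finset.univ_eq_empty, Finset.prod_empty]
  exact integral_indicator_one h

end SwitchingPDE

/-! Fix the points and let `Z t` be the product of the values `u (x m) t`, so that the moment is the
expectation of `Z t` on the event `J t = i`. For `s ≤ t` its increment is the expectation of `Z t -
Z s` on `J t = i`, plus the sum over `j` of the expectation of `Z s` on `J s = j` times the
increment of the `(j, i)` entry of `exp (r Q)` from `r = 0` to `r = t - s`; this is the Markov
property, since `Z s` depends only on the past. Divided by the time step, the second part tends to
the `Q`-term and the first to the expectation of the time derivative of `Z`
(`IsMarkovJumpProcess.hasDerivAt_setIntegral`).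

The limit in the first part needs dominated difference quotients, whereas the hypotheses bound the
derivatives only almost surely at each fixed point and time. In time, Fubini turns this into a bound
at almost every time of almost every path; as a path fails to be differentiable at only countably
many times, it is Lipschitz (`ae_lipschitz_of_ae_abs_deriv_le`). In space, continuity extends the
bound from a countable dense set (`ae_forall_abs_le`), so derivatives, and hence the operators, pass
under the expectation.

In a single spatial variable the moment is the expectation of `u y t` against a bounded weight that
vanishes off `J t = i`. On that event the boundary data are deterministic, and the integrable
gradient bound lets the normal derivative pass under the expectation
(`IsSolution.hasNormalDeriv_integral`). -/

namespace SwitchingPDE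

/-! ### Paths of the jump process and the Markov property -/

section JumpProcess

variable {Ω I : Type*} [MeasurableSpace Ω] [Fintype I] [DecidableEq I] {μ : Measure Ω}
  {Q : Matrix I I ℝ} {J : ℝ → Ω → I}

theorem IsMarkovJumpProcess.measurableSet_preimage (hJ : IsMarkovJumpProcess μ Q J) {t : ℝ}
    (ht : 0 ≤ t) (S : Set I) : MeasurableSet (J t ⁻¹' S) := by
  have : J t ⁻¹' S = ⋃ i ∈ S, {ω | J t ω = i} := by
    ext ω
    simp
  rw [this]
  exact MeasurableSet.biUnion S.to_countable fun i _ => hJ.measurable t ht i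

theorem IsMarkovJumpProcess.past_le (hJ : IsMarkovJumpProcess μ Q J) (t : ℝ) :
    past J t ≤ ‹MeasurableSpace Ω› := by
  refine iSup₂_le fun s hs => ?_
  rintro _ ⟨S, -, rfl⟩
  exact hJ.measurableSet_preimage hs.1 S

theorem IsMarkovJumpProcess.measurableSet_ne (hJ : IsMarkovJumpProcess μ Q J) {s t : ℝ}
    (hs : 0 ≤ s) (ht : 0 ≤ t) : MeasurableSet {ω | J s ω ≠ J t ω} := by
  have : {ω | J s ω ≠ J t ω} = ⋃ i, {ω | J s ω = i} ∩ {ω | J t ω = i}ᶜ := by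
    ext ω
    simp [eq_comm]
  rw [this]
  exact MeasurableSet.iUnion fun i => (hJ.measurable s hs i).inter (hJ.measurable t ht i).compl

theorem hasDerivAt_exp_smul_apply (Q : Matrix I I ℝ) (i j : I) :
    HasDerivAt (fun h : ℝ => NormedSpace.exp (h • Q) i j) (Q i j) 0 := by
  let _ : NormedRing (Matrix I I ℝ) := Matrix.linftyOpNormedRing
  let _ : NormedAlgebra ℝ (Matrix I I ℝ) := Matrix.linftyOpNormedAlgebra
  have h := hasDerivAt_exp_smul_const (𝕂 := ℝ) Q 0
  have h2 := (LinearMap.toContinuousLinearMap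
    (Matrix.entryLinearMap ℝ ℝ i j)).hasFDerivAt.comp_hasDerivAt (0 : ℝ) h
  have h3 : LinearMap.toContinuousLinearMap (Matrix.entryLinearMap ℝ ℝ i j)
      (NormedSpace.exp ((0 : ℝ) • Q) * Q) = Q i j := by
    rw [zero_smul, NormedSpace.exp_zero, one_mul]
    rfl
  exact h3 ▸ h2

theorem exp_zero_smul_apply (Q : Matrix I I ℝ) (i j : I) :
    NormedSpace.exp ((0 : ℝ) • Q) i j = if i = j then 1 else 0 := by
  simp [Matrix.one_apply]

/-- Splitting by the state at time `s`, each piece is a departure probability given by the Markov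
property. The absolute values make it unnecessary to know that the diagonal entries are at most `1`.
The bound depends only on `t - s` and vanishes with it. -/
theorem IsMarkovJumpProcess.real_ne_le [IsProbabilityMeasure μ] (hJ : IsMarkovJumpProcess μ Q J)
    {s t : ℝ} (hs : 0 ≤ s) (hst : s ≤ t) :
    μ.real {ω | J s ω ≠ J t ω} ≤ ∑ i, |1 - NormedSpace.exp ((t - s) • Q) i i| := by
  have : {ω | J s ω ≠ J t ω} = ⋃ i ∈ Finset.univ, {ω | J s ω = i} \ {ω | J t ω = i} := by
    ext ω
    simp [eq_comm]
  rw [this]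
  refine (measureReal_biUnion_finset_le _ _).trans (Finset.sum_le_sum fun i _ => ?_)
  have h1 := hJ.markov s t hs hst i i univ MeasurableSet.univ
  rw [univ_inter] at h1
  have h2 := measureReal_inter_add_sdiff (μ := μ) (s := {ω | J s ω = i})
    (hJ.measurable t (hs.trans hst) i)
  rw [h1] at h2
  have h3 : μ.real ({ω | J s ω = i} \ {ω | J t ω = i}) =
      μ.real {ω | J s ω = i} * (1 - NormedSpace.exp ((t - s) • Q) i i) := by linarith
  rw [h3]
  calc _ ≤ μ.real {ω | J s ω = i} * |1 - NormedSpace.exp ((t - s) • Q) i i| :=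
        mul_le_mul_of_nonneg_left (le_abs_self _) measureReal_nonneg
    _ ≤ _ := mul_le_of_le_one_left (abs_nonneg _) measureReal_le_one

theorem IsMarkovJumpProcess.tendsto_real_ne [IsProbabilityMeasure μ]
    (hJ : IsMarkovJumpProcess μ Q J) {t : ℝ} (ht : 0 < t) :
    Tendsto (fun s => μ.real {ω | J s ω ≠ J t ω}) (𝓝 t) (𝓝 0) := by
  have hlim : Tendsto (fun s => ∑ i, |1 - NormedSpace.exp (|t - s| • Q) i i|) (𝓝 t) (𝓝 0) := by
    have h0 : Tendsto (fun s => |t - s|) (𝓝 t) (𝓝 0) := by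
      have : Continuous fun s : ℝ => |t - s| := by fun_prop
      simpa using this.tendsto t
    have h1 : ∀ i, Tendsto (fun s => |1 - NormedSpace.exp (|t - s| • Q) i i|) (𝓝 t) (𝓝 0) := by
      intro i
      have h2 := ((hasDerivAt_exp_smul_apply Q i i).continuousAt.tendsto).comp h0
      have h3 := (tendsto_const_nhds (x := (1 : ℝ))).sub h2
      rw [exp_zero_smul_apply, if_pos rfl, sub_self] at h3
      simpa using h3.abs
    simpa using tendsto_finsetSum Finset.univ fun i _ => h1 i
  refine tendsto_of_tendsto_of_tendsto_of_le_of_le' tendsto_const_nhds hlim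
    (Eventually.of_forall fun _ => measureReal_nonneg) ?_
  filter_upwards [Ioi_mem_nhds ht] with s hs
  rcases le_total s t with hst | hst
  · rw [abs_of_nonneg (sub_nonneg.2 hst)]
    exact hJ.real_ne_le (le_of_lt hs) hst
  · rw [abs_of_nonpos (sub_nonpos.2 hst), neg_sub]
    simpa only [ne_comm] using hJ.real_ne_le ht.le hst

/-- A fixed time is almost surely not a jump time. -/
theorem IsMarkovJumpProcess.ae_noJumpAt [IsProbabilityMeasure μ]
    (hJ : IsMarkovJumpProcess μ Q J) {t : ℝ} (ht : 0 < t) : ∀ᵐ ω ∂μ, NoJumpAt J t ω := by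
  obtain ⟨r, -, hr, hrt⟩ := exists_seq_strictMono_tendsto' ht
  have hrt' : Tendsto r atTop (𝓝[<] t) :=
    tendsto_nhdsWithin_iff.2 ⟨hrt, Eventually.of_forall fun n => (hr n).2⟩
  -- The probability that `J (r n)` differs from `J t` tends to zero, so almost surely the path
  -- takes the value `J t` at some `r n` arbitrarily close before `t`. The left limit must then be
  -- `J t`.
  have hev : ∀ᵐ ω ∂μ, ∀ N, ∃ n ≥ N, J (r n) ω = J t ω := by
    rw [ae_all_iff]
    intro N
    have h0 : μ.real (⋂ n ≥ N, {ω | J (r n) ω ≠ J t ω}) ≤ 0 := by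
      refine ge_of_tendsto ((hJ.tendsto_real_ne ht).comp hrt) ?_
      filter_upwards [eventually_ge_atTop N] with n hn
      exact measureReal_mono (biInter_subset_of_mem hn)
    have h1 := (measureReal_eq_zero_iff).1 (le_antisymm h0 measureReal_nonneg)
    filter_upwards [measure_eq_zero_iff_ae_notMem.1 h1] with ω hω
    simpa using hω
  filter_upwards [hev, hJ.right_continuous, hJ.left_limits] with ω h1 h2 h3
  obtain ⟨i, hi⟩ := h3 t ht
  obtain ⟨N, hN⟩ := eventually_atTop.1 (hrt'.eventually hi)
  obtain ⟨n, hn, hn'⟩ := h1 N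
  have hit : J t ω = i := hn'.symm.trans (hN n hn)
  have h4 : ∀ᶠ s in 𝓝[<] t ⊔ 𝓝[>] t, J s ω = J t ω :=
    eventually_sup.2 ⟨hit ▸ hi, h2 t ht.le⟩
  rw [nhdsLT_sup_nhdsGT, eventually_nhdsWithin_iff] at h4
  filter_upwards [h4] with s hs
  by_cases hst : s = t
  · rw [hst]
  · exact hs hst

/-- Almost surely, there are only countably many jump times. -/
theorem IsMarkovJumpProcess.ae_countable_jumps (hJ : IsMarkovJumpProcess μ Q J) :
    ∀ᵐ ω ∂μ, {t | 0 < t ∧ ¬ NoJumpAt J t ω}.Countable := by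
  filter_upwards [hJ.right_continuous, hJ.left_limits] with ω hr hl
  set S := {t | 0 < t ∧ ¬ NoJumpAt J t ω}
  have hloc : ∀ (i : I) (s : Set ℝ), IsOpen s → (∀ r ∈ s, J r ω = i) → ∀ r ∈ s, r ∉ S := by
    rintro i s hs his r hrs ⟨-, hrS⟩
    refine hrS ?_
    filter_upwards [hs.mem_nhds hrs] with q hq
    rw [his q hq, his r hrs]
  -- Every positive time has a constancy interval on each side, and these contain no jump; the jump
  -- times form a discrete subspace of the line, and a discrete Lindelöf space is countable.
  have hdisc : DiscreteTopology S := by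
    rw [discreteTopology_subtype_iff]
    intro t ht
    obtain ⟨i, hi⟩ := hl t ht.1
    obtain ⟨l, hlt, hl'⟩ := (mem_nhdsLT_iff_exists_Ioo_subset).1 hi
    obtain ⟨u, hut, hu'⟩ := (mem_nhdsGT_iff_exists_Ioo_subset).1 (hr t ht.1.le)
    rw [inf_principal_eq_bot, ← nhdsLT_sup_nhdsGT]
    refine mem_sup.2 ⟨?_, ?_⟩
    · filter_upwards [Ioo_mem_nhdsLT hlt] with r hr
      exact hloc i (Ioo l t) isOpen_Ioo (fun q hq => hl' hq) r hr
    · filter_upwards [Ioo_mem_nhdsGT hut] with r hr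
      exact hloc _ (Ioo t u) isOpen_Ioo (fun q hq => hu' hq) r hr
  exact (countable_of_Lindelof_of_discrete (X := S))

/-- The Markov property for integrals of functions of the past. -/
theorem IsMarkovJumpProcess.setIntegral_inter [IsProbabilityMeasure μ]
    (hJ : IsMarkovJumpProcess μ Q J) {s t : ℝ} (hs : 0 ≤ s) (hst : s ≤ t) (i j : I) {Z : Ω → ℝ}
    (hZ : AEStronglyMeasurable[past J s] Z μ) :
    ∫ ω in {ω | J s ω = i} ∩ {ω | J t ω = j}, Z ω ∂μ =
      (∫ ω in {ω | J s ω = i}, Z ω ∂μ) * NormedSpace.exp ((t - s) • Q) i j := by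
  set p := NormedSpace.exp ((t - s) • Q) i j with hp
  have hm := hJ.past_le s
  have hSi : MeasurableSet {ω | J s ω = i} := hJ.measurable s hs i
  obtain ⟨Y, hY, hZY⟩ := hZ
  rw [integral_congr_ae (ae_restrict_of_ae hZY), integral_congr_ae (ae_restrict_of_ae hZY),
    integral_trim hm hY, integral_trim hm hY]
  -- For `p ≥ 0` the Markov property says that the two restricted measures are proportional on the
  -- past. Positivity of the transition entry is not proved: if `p < 0`, the Markov property itself
  -- forces `J s = i` to be a null event.
  rcases le_or_gt 0 p with hp0 | hp0
  · have hmeas : (μ.restrict ({ω | J s ω = i} ∩ {ω | J t ω = j})).trim hm =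
        ENNReal.ofReal p • (μ.restrict {ω | J s ω = i}).trim hm := by
      refine @Measure.ext _ (past J s) _ _ fun A hA => ?_
      rw [trim_measurableSet_eq hm hA, Measure.smul_apply, trim_measurableSet_eq hm hA,
        Measure.restrict_apply (hm A hA), Measure.restrict_apply (hm A hA), ← inter_assoc, smul_eq_mul]
      have h := hJ.markov s t hs hst i j A hA
      rw [← ENNReal.toReal_eq_toReal_iff' (measure_ne_top _ _)
        (ENNReal.mul_ne_top ENNReal.ofReal_ne_top (measure_ne_top _ _))]
      rw [ENNReal.toReal_mul, ENNReal.toReal_ofReal hp0, mul_comm]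
      exact h
    rw [hmeas, integral_smul_measure, ENNReal.toReal_ofReal hp0, smul_eq_mul, mul_comm]
  · have h := hJ.markov s t hs hst i j univ MeasurableSet.univ
    rw [univ_inter, ← hp] at h
    have h0 : μ.real {ω | J s ω = i} = 0 := by
      by_contra hne
      have h1 : 0 < μ.real {ω | J s ω = i} := lt_of_le_of_ne measureReal_nonneg (Ne.symm hne)
      have h2 := mul_neg_of_pos_of_neg h1 hp0
      rw [← h] at h2
      exact absurd h2 (not_lt.2 measureReal_nonneg)
    rw [measureReal_eq_zero_iff] at h0
    have h1 : μ ({ω | J s ω = i} ∩ {ω | J t ω = j}) = 0 := measure_mono_null inter_subset_left h0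
    rw [Measure.restrict_eq_zero.2 h0, Measure.restrict_eq_zero.2 h1]
    simp

end JumpProcess

/-! ### From fixed-time bounds to Lipschitz paths -/

/-- A process that is almost surely continuous on `(0, ∞)` is almost surely equal, at all positive
times simultaneously, to a jointly measurable one. -/
theorem exists_measurable_uncurry {Ω : Type*} [MeasurableSpace Ω] {μ : Measure Ω}
    {f : ℝ → Ω → ℝ} (hm : ∀ t, 0 < t → AEStronglyMeasurable (f t) μ)
    (hc : ∀ᵐ ω ∂μ, ContinuousOn (fun t => f t ω) (Ioi 0)) :
    ∃ g : ℝ × Ω → ℝ, Measurable g ∧ ∀ᵐ ω ∂μ, ∀ t, 0 < t → g (t, ω) = f t ω := by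
  classical
  let q : ℕ → ℤ → ℝ := fun n k => (k : ℝ) / (n + 1)
  let F : ℕ → ℤ × Ω → ℝ := fun n p => if h : 0 < q n p.1 then (hm _ h).mk _ p.2 else 0
  have hF : ∀ n, Measurable (F n) := fun n => by
    refine measurable_from_prod_countable_right fun k => ?_
    by_cases h : 0 < q n k
    · simpa [F, h] using (hm _ h).stronglyMeasurable_mk.measurable
    · simp [F, h]
  -- The path is sampled at the grid point `⌈(n + 1) t⌉ / (n + 1)`, which is positive when `t` is.
  -- For each `n` only countably many sampling times occur, so measurability at fixed times
  -- suffices. The `limsup` below is measurable even where the samples do not converge.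
  let G : ℕ → ℝ × Ω → ℝ := fun n p => F n (⌈((n : ℝ) + 1) * p.1⌉, p.2)
  have hG : ∀ n, Measurable (G n) := fun n => by
    refine (hF n).comp (Measurable.prodMk ?_ measurable_snd)
    exact Int.measurable_ceil.comp (measurable_fst.const_mul _)
  refine ⟨fun p => limsup (fun n => G n p) atTop, .limsup hG, ?_⟩
  have hmk : ∀ᵐ ω ∂μ, ∀ n k, ∀ h : 0 < q n k, f (q n k) ω = (hm _ h).mk _ ω := by
    simp_rw [ae_all_iff]
    exact fun n k h => (hm _ h).ae_eq_mk
  filter_upwards [hc, hmk] with ω hcω hmkω t ht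
  refine Tendsto.limsup_eq ?_
  have hlim : Tendsto (fun n : ℕ => (⌈((n : ℝ) + 1) * t⌉ : ℝ) / ((n : ℝ) + 1)) atTop (𝓝 t) := by
    have h1 : Tendsto (fun n : ℕ => t + 1 / ((n : ℝ) + 1)) atTop (𝓝 t) := by
      simpa using tendsto_const_nhds.add (tendsto_one_div_add_atTop_nhds_zero_nat (𝕜 := ℝ))
    refine tendsto_of_tendsto_of_tendsto_of_le_of_le tendsto_const_nhds h1 (fun n => ?_)
      (fun n => ?_)
    · have : (0 : ℝ) < n + 1 := by positivity
      rw [le_div_iff₀ this, mul_comm]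
      exact Int.le_ceil _
    · have : (0 : ℝ) < n + 1 := by positivity
      have h2 : (t + 1 / ((n : ℝ) + 1)) * (n + 1) = (n + 1) * t + 1 := by field_simp
      simp only
      rw [div_le_iff₀ this, h2]
      exact (Int.ceil_lt_add_one _).le
  have hpos : ∀ n : ℕ, 0 < q n ⌈((n : ℝ) + 1) * t⌉ := fun n => by
    have : (0 : ℝ) < n + 1 := by positivity
    have h2 : (0 : ℝ) < ⌈((n : ℝ) + 1) * t⌉ := (mul_pos this ht).trans_le (Int.le_ceil _)
    positivity
  have heq : (fun n => G n (t, ω)) = fun n : ℕ => f (q n ⌈((n : ℝ) + 1) * t⌉) ω := by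
    funext n
    simp only [G, F, dif_pos (hpos n)]
    exact (hmkω n _ (hpos n)).symm
  rw [heq]
  exact ((hcω.continuousAt (Ioi_mem_nhds ht)).tendsto).comp hlim

/-- A continuous function that is differentiable off a countable set, with derivative almost
everywhere bounded by `K`, is `K`-Lipschitz. -/
theorem abs_sub_le_of_ae_abs_deriv_le {f : ℝ → ℝ} {a b K : ℝ} {S : Set ℝ} (hS : S.Countable)
    (hc : ContinuousOn f (Icc a b)) (hd : ∀ t ∈ Ioo a b \ S, DifferentiableAt ℝ f t)
    (hK : ∀ᵐ t, t ∈ Icc a b → |deriv f t| ≤ K) {s t : ℝ} (hs : s ∈ Icc a b) (ht : t ∈ Icc a b) :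
    |f t - f s| ≤ K * |t - s| := by
  have hsub : uIcc s t ⊆ Icc a b := uIcc_subset_Icc hs ht
  have hK' : ∀ᵐ r, r ∈ Set.uIoc s t → ‖deriv f r‖ ≤ K := by
    filter_upwards [hK] with r hr hrs
    exact hr (hsub (uIoc_subset_uIcc hrs))
  have hint : IntervalIntegrable (deriv f) volume s t := by
    rw [intervalIntegrable_iff]
    refine Measure.integrableOn_of_bounded (M := K) ?_ (measurable_deriv f).aestronglyMeasurable ?_
    · simp [uIoc]
    · rwa [ae_restrict_iff' measurableSet_uIoc]
  have hsubo : Ioo (min s t) (max s t) ⊆ Ioo a b :=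
    Ioo_subset_Ioo (le_min hs.1 ht.1) (max_le hs.2 ht.2)
  rw [← integral_eq_of_hasDerivAt_off_countable f (deriv f) hS (hc.mono hsub)
    (fun r hr => (hd r ⟨hsubo hr.1, hr.2⟩).hasDerivAt) hint]
  exact intervalIntegral.norm_integral_le_of_norm_le_const_ae hK'

/-- If, at each fixed time, the derivative of a continuous process almost surely exists and is
bounded by `K`, and the paths are differentiable off countable sets, then almost all paths are
`K`-Lipschitz. -/
theorem ae_lipschitz_of_ae_abs_deriv_le {Ω : Type*} [MeasurableSpace Ω] {μ : Measure Ω}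
    [SFinite μ] {f : ℝ → Ω → ℝ} (hm : ∀ t, 0 < t → AEStronglyMeasurable (f t) μ)
    (hc : ∀ᵐ ω ∂μ, ContinuousOn (fun t => f t ω) (Ioi 0))
    (hd : ∀ᵐ ω ∂μ, {t | 0 < t ∧ ¬ DifferentiableAt ℝ (fun t => f t ω) t}.Countable)
    {a b K : ℝ} (ha : 0 < a) (hK0 : 0 ≤ K)
    (hK : ∀ t ∈ Icc a b, ∀ᵐ ω ∂μ, DifferentiableAt ℝ (fun t => f t ω) t ∧
      |deriv (fun t => f t ω) t| ≤ K) :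
    ∀ᵐ ω ∂μ, ∀ s ∈ Icc a b, ∀ t ∈ Icc a b, |f t ω - f s ω| ≤ K * |t - s| := by
  obtain ⟨g, hg, hgf⟩ := exists_measurable_uncurry hm hc
  -- A jointly measurable stand-in for the absolute value of the time derivative, as the exchange of
  -- "almost every `t`" and "almost every `ω`" requires. It agrees with it wherever the path is
  -- differentiable.
  let R : ℝ → Ω → ENNReal := fun t ω => liminf (fun n : ℕ =>
    ‖((n : ℝ) + 1) * (g (t + 1 / ((n : ℝ) + 1), ω) - g (t, ω))‖ₑ) atTop
  have hR : Measurable (Function.uncurry R) := by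
    refine Measurable.liminf fun n => Measurable.enorm ?_
    refine Measurable.const_mul ?_ _
    refine (hg.comp ?_).sub (hg.comp ?_)
    · exact (measurable_fst.add_const _).prodMk measurable_snd
    · exact measurable_fst.prodMk measurable_snd
  have key : ∀ ω, (∀ t, 0 < t → g (t, ω) = f t ω) → ∀ t, 0 < t →
      DifferentiableAt ℝ (fun t => f t ω) t → R t ω = ‖deriv (fun t => f t ω) t‖ₑ := by
    intro ω hω t ht hdt
    refine Tendsto.liminf_eq ?_
    have h0 : Tendsto (fun n : ℕ => 1 / ((n : ℝ) + 1)) atTop (𝓝[≠] 0) := by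
      refine tendsto_nhdsWithin_iff.2 ⟨tendsto_one_div_add_atTop_nhds_zero_nat, ?_⟩
      exact Eventually.of_forall fun n => (by positivity : (0 : ℝ) < 1 / ((n : ℝ) + 1)).ne'
    have h1 := (hdt.hasDerivAt.tendsto_slope_zero.comp h0).enorm
    refine h1.congr fun n => ?_
    have : 0 < t + 1 / ((n : ℝ) + 1) := by positivity
    rw [hω t ht, hω _ this]
    simp
  have hae : ∀ᵐ t, ∀ᵐ ω ∂μ, t ∈ Icc a b → R t ω ≤ ENNReal.ofReal K := by
    refine Eventually.of_forall fun t => ?_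
    by_cases ht : t ∈ Icc a b
    · filter_upwards [hgf, hK t ht] with ω h1 h2 _
      rw [key ω h1 t (ha.trans_le ht.1) h2.1, Real.enorm_eq_ofReal_abs]
      exact ENNReal.ofReal_le_ofReal h2.2
    · exact Eventually.of_forall fun ω h => absurd h ht
  have hae' : ∀ᵐ ω ∂μ, ∀ᵐ t, t ∈ Icc a b → R t ω ≤ ENNReal.ofReal K := by
    refine (Measure.ae_ae_comm ?_).1 hae
    have : {x : ℝ × Ω | x.1 ∈ Icc a b → R x.1 x.2 ≤ ENNReal.ofReal K} =
        {x : ℝ × Ω | x.1 ∈ Icc a b}ᶜ ∪ {x | Function.uncurry R x ≤ ENNReal.ofReal K} := by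
      ext x
      simp only [mem_ofPred_eq, mem_union, mem_compl_iff, Function.uncurry]
      tauto
    rw [this]
    exact (measurable_fst measurableSet_Icc).compl.union (measurableSet_le hR measurable_const)
  filter_upwards [hc, hd, hgf, hae'] with ω hcω hdω hgω hRω s hs t ht
  have hab : Icc a b ⊆ Ioi 0 := fun r hr => ha.trans_le hr.1
  refine abs_sub_le_of_ae_abs_deriv_le hdω (hcω.mono hab) (fun r hr => ?_) ?_ hs ht
  · by_contra hcon
    exact hr.2 ⟨ha.trans hr.1.1, hcon⟩
  · have hnull : ∀ᵐ r, r ∉ {t | 0 < t ∧ ¬ DifferentiableAt ℝ (fun t => f t ω) t} :=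
      measure_eq_zero_iff_ae_notMem.1 (hdω.measure_zero volume)
    filter_upwards [hRω, hnull] with r hr hr' hrab
    have hr0 : 0 < r := hab hrab
    have hdr : DifferentiableAt ℝ (fun t => f t ω) r := by
      by_contra hcon
      exact hr' ⟨hr0, hcon⟩
    have := hr hrab
    rw [key ω hgω r hr0 hdr, Real.enorm_eq_ofReal_abs] at this
    exact (ENNReal.ofReal_le_ofReal_iff hK0).1 this

/-! ### The forward equation for adapted Lipschitz processes -/

theorem abs_setIntegral_sub_le {Ω : Type*} [MeasurableSpace Ω] {μ : Measure Ω} [IsFiniteMeasure μ]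
    {A B D : Set Ω} (hA : MeasurableSet A) (hB : MeasurableSet B) (hD : MeasurableSet D)
    (hAB : ∀ ω ∉ D, ω ∈ A ↔ ω ∈ B) {f : Ω → ℝ} (hf : AEStronglyMeasurable f μ) {c : ℝ}
    (hc : ∀ᵐ ω ∂μ, |f ω| ≤ c) :
    |∫ ω in A, f ω ∂μ - ∫ ω in B, f ω ∂μ| ≤ c * μ.real D := by
  have hint : Integrable f μ := .of_bound hf c hc
  rw [← integral_indicator hA, ← integral_indicator hB,
    ← integral_sub (hint.indicator hA) (hint.indicator hB)]
  calc _ ≤ ∫ ω, D.indicator (fun _ => c) ω ∂μ := by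
        rw [← Real.norm_eq_abs]
        refine norm_integral_le_of_norm_le ((integrable_const (μ := μ) c).indicator hD) ?_
        filter_upwards [hc] with ω hω
        have h0 := (abs_nonneg _).trans hω
        by_cases hωD : ω ∈ D
        · rw [indicator_of_mem hωD]
          by_cases h1 : ω ∈ A <;> by_cases h2 : ω ∈ B <;> simp [h1, h2, hω, h0]
        · by_cases h1 : ω ∈ A
          · simp [h1, (hAB ω hωD).1 h1, hωD]
          · have h2 : ω ∉ B := fun h => h1 ((hAB ω hωD).2 h)
            simp [h1, h2, hωD]
    _ = c * μ.real D := by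
        rw [integral_indicator hD, setIntegral_const, smul_eq_mul, mul_comm]

section JumpProcess

variable {Ω I : Type*} [MeasurableSpace Ω] [Fintype I] [DecidableEq I] {μ : Measure Ω}
  [IsProbabilityMeasure μ] {Q : Matrix I I ℝ} {J : ℝ → Ω → I}

/-- The two events differ only where `J` has changed between the two times, and this has small
probability when the times are close. -/
theorem IsMarkovJumpProcess.abs_setIntegral_sub_le (hJ : IsMarkovJumpProcess μ Q J) {s t : ℝ}
    (hs : 0 ≤ s) (ht : 0 ≤ t) (i : I) {f : Ω → ℝ} (hf : AEStronglyMeasurable f μ) {c : ℝ}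
    (hc : ∀ᵐ ω ∂μ, |f ω| ≤ c) :
    |∫ ω in {ω | J s ω = i}, f ω ∂μ - ∫ ω in {ω | J t ω = i}, f ω ∂μ| ≤
      c * μ.real {ω | J s ω ≠ J t ω} := by
  refine SwitchingPDE.abs_setIntegral_sub_le (hJ.measurable s hs i) (hJ.measurable t ht i)
    (hJ.measurableSet_ne hs ht) (fun ω hω => ?_) hf hc
  have : J s ω = J t ω := by simpa using hω
  simp [this]

theorem IsMarkovJumpProcess.setIntegral_eq_sum (hJ : IsMarkovJumpProcess μ Q J) {s t : ℝ}
    (hs : 0 ≤ s) (hst : s ≤ t) (i : I) {Z : Ω → ℝ}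
    (hZ : AEStronglyMeasurable[past J s] Z μ) (hint : Integrable Z μ) :
    ∫ ω in {ω | J t ω = i}, Z ω ∂μ =
      ∑ j, (∫ ω in {ω | J s ω = j}, Z ω ∂μ) * NormedSpace.exp ((t - s) • Q) j i := by
  have h : {ω | J t ω = i} = ⋃ j, {ω | J s ω = j} ∩ {ω | J t ω = i} := by
    ext ω
    simp
  rw [h, integral_iUnion_fintype]
  · exact Finset.sum_congr rfl fun j _ => hJ.setIntegral_inter hs hst j i hZ
  · exact fun j => (hJ.measurable s hs j).inter (hJ.measurable t (hs.trans hst) i)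
  · intro j k hjk
    refine Set.disjoint_left.2 fun ω h1 h2 => hjk ?_
    exact h1.1.symm.trans h2.1
  · exact fun j => hint.integrableOn

/-- The increment of `E[1_{J t = i} Z t]` splits into the increment of `Z` and the transitions
of `J`. -/
theorem IsMarkovJumpProcess.setIntegral_sub_eq (hJ : IsMarkovJumpProcess μ Q J) {s t : ℝ}
    (hs : 0 ≤ s) (hst : s ≤ t) (i : I) {Z Y : Ω → ℝ}
    (hZ : AEStronglyMeasurable[past J s] Z μ) (hZi : Integrable Z μ) (hYi : Integrable Y μ) :
    ∫ ω in {ω | J t ω = i}, Y ω ∂μ - ∫ ω in {ω | J s ω = i}, Z ω ∂μ =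
      ∫ ω in {ω | J t ω = i}, (Y ω - Z ω) ∂μ +
      ∑ j, (∫ ω in {ω | J s ω = j}, Z ω ∂μ) *
        (NormedSpace.exp ((t - s) • Q) j i - NormedSpace.exp ((0 : ℝ) • Q) j i) := by
  rw [integral_sub hYi.integrableOn hZi.integrableOn, hJ.setIntegral_eq_sum hs hst i hZ hZi]
  simp only [mul_sub, Finset.sum_sub_distrib, exp_zero_smul_apply]
  simp

/-- The forward equation for `E[1_{J t = i} Z t]`, for a bounded Lipschitz adapted process `Z`. -/
theorem IsMarkovJumpProcess.hasDerivAt_setIntegral (hJ : IsMarkovJumpProcess μ Q J)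
    {Z : ℝ → Ω → ℝ} {Z' : Ω → ℝ} {a b t C K : ℝ} (ha : 0 < a) (hat : a < t) (htb : t < b)
    (hZm : ∀ s, 0 < s → AEStronglyMeasurable[past J s] (Z s) μ)
    (hC : ∀ s ∈ Icc a b, ∀ᵐ ω ∂μ, |Z s ω| ≤ C)
    (hK : ∀ᵐ ω ∂μ, ∀ s ∈ Icc a b, ∀ r ∈ Icc a b, |Z r ω - Z s ω| ≤ K * |r - s|)
    (hZ' : ∀ᵐ ω ∂μ, HasDerivAt (fun s => Z s ω) (Z' ω) t) (i : I) :
    HasDerivAt (fun s => ∫ ω in {ω | J s ω = i}, Z s ω ∂μ)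
      (∫ ω in {ω | J t ω = i}, Z' ω ∂μ + ∑ j, Q j i * ∫ ω in {ω | J t ω = j}, Z t ω ∂μ) t := by
  have ht0 : 0 < t := ha.trans hat
  have htm : t ∈ Icc a b := ⟨hat.le, htb.le⟩
  have hnhds : Icc a b ∈ 𝓝 t := Icc_mem_nhds hat htb
  have hm : ∀ s, 0 < s → AEStronglyMeasurable (Z s) μ := fun s hs => (hZm s hs).mono (hJ.past_le s)
  have hpos : ∀ s ∈ Icc a b, 0 < s := fun s hs => ha.trans_le hs.1
  have hint : ∀ s ∈ Icc a b, Integrable (Z s) μ := fun s hs =>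
    .of_bound (hm s (hpos s hs)) C (hC s hs)
  set w : I → ℝ → ℝ := fun j s => ∫ ω in {ω | J s ω = j}, Z s ω ∂μ with hw
  set N : ℝ → ℝ := fun s => μ.real {ω | J s ω ≠ J t ω} with hN
  have hN0 : Tendsto N (𝓝 t) (𝓝 0) := hJ.tendsto_real_ne ht0
  have hlip : ∀ s ∈ Icc a b, ∀ᵐ ω ∂μ, |Z s ω - Z t ω| ≤ K * |s - t| := fun s hs => by
    filter_upwards [hK] with ω hω
    exact hω t htm s hs
  -- Moving the event from time `s` to time `t` costs at most `C * N s`; moving the process costs at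
  -- most `K * |s - t|` times the probability of the event.
  have hwc : ∀ j, ContinuousAt (w j) t := by
    intro j
    have hlim : Tendsto (fun s => C * N s + K * |s - t| * μ.real {ω | J t ω = j}) (𝓝 t) (𝓝 0) := by
      have h1 : Tendsto (fun s => K * |s - t| * μ.real {ω | J t ω = j}) (𝓝 t) (𝓝 0) := by
        have : Continuous fun s : ℝ => K * |s - t| * μ.real {ω | J t ω = j} := by fun_prop
        simpa using this.tendsto t
      simpa using (hN0.const_mul C).add h1
    refine tendsto_iff_dist_tendsto_zero.2 (squeeze_zero' (Eventually.of_forall fun _ =>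
      dist_nonneg) ?_ hlim)
    filter_upwards [hnhds] with s hs
    have h1 := hJ.abs_setIntegral_sub_le (hpos s hs).le ht0.le j (hm s (hpos s hs)) (hC s hs)
    have h2 : |∫ ω in {ω | J t ω = j}, (Z s ω - Z t ω) ∂μ| ≤
        K * |s - t| * μ.real {ω | J t ω = j} := by
      rw [← Real.norm_eq_abs]
      exact norm_setIntegral_le_of_norm_le_const_ae (measure_lt_top _ _)
        (ae_restrict_of_ae (hlip s hs))
    rw [integral_sub (hint s hs).integrableOn (hint t htm).integrableOn] at h2
    rw [Real.dist_eq]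
    calc |w j s - w j t| ≤ _ := abs_sub_le _ (∫ ω in {ω | J t ω = j}, Z s ω ∂μ) _
      _ ≤ _ := add_le_add h1 h2
  rw [hasDerivAt_iff_tendsto_slope]
  -- An approximate slope valid on both sides of `t`: transitions start at the earlier time `min s
  -- t`, since the Markov property only runs forward, while the increment of `Z` is always taken on
  -- the event `J t = i`.
  set A : ℝ → ℝ := fun s => ∫ ω in {ω | J t ω = i}, slope (fun s => Z s ω) t s ∂μ +
    ∑ j, w j (min s t) * (|s - t|⁻¹ *
      (NormedSpace.exp (|s - t| • Q) j i - NormedSpace.exp ((0 : ℝ) • Q) j i)) with hA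
  have hAlim : Tendsto A (𝓝[≠] t)
      (𝓝 (∫ ω in {ω | J t ω = i}, Z' ω ∂μ + ∑ j, Q j i * w j t)) := by
    refine Tendsto.add ?_ (tendsto_finsetSum _ fun j _ => ?_)
    · refine tendsto_integral_filter_of_dominated_convergence (fun _ => K) ?_ ?_
        (integrable_const K) ?_
      · filter_upwards [nhdsWithin_le_nhds hnhds] with s hs
        simp only [slope_def_field, div_eq_inv_mul]
        exact (((hm s (hpos s hs)).sub (hm t ht0)).const_mul _).restrict
      · filter_upwards [nhdsWithin_le_nhds hnhds, self_mem_nhdsWithin] with s hs hst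
        refine ae_restrict_of_ae ?_
        filter_upwards [hlip s hs] with ω hω
        have : 0 < |s - t| := abs_pos.2 (sub_ne_zero.2 hst)
        rw [slope_def_field, norm_div, Real.norm_eq_abs, Real.norm_eq_abs, div_le_iff₀ this]
        exact hω
      · refine ae_restrict_of_ae ?_
        filter_upwards [hZ'] with ω hω
        exact hasDerivAt_iff_tendsto_slope.1 hω
    · rw [mul_comm]
      refine Tendsto.mul ?_ ?_
      · have h1 : Tendsto (fun s => min s t) (𝓝[≠] t) (𝓝 t) := by
          have : Continuous fun s : ℝ => min s t := by fun_prop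
          simpa using (this.tendsto t).mono_left nhdsWithin_le_nhds
        exact (hwc j).tendsto.comp h1
      · have h0 : Tendsto (fun s => |s - t|) (𝓝[≠] t) (𝓝[≠] 0) := by
          refine tendsto_nhdsWithin_iff.2 ⟨?_, ?_⟩
          · have : Continuous fun s : ℝ => |s - t| := by fun_prop
            simpa using (this.tendsto t).mono_left nhdsWithin_le_nhds
          · filter_upwards [self_mem_nhdsWithin] with s hs
            exact (abs_pos.2 (sub_ne_zero.2 hs)).ne'
        have h1 := (hasDerivAt_exp_smul_apply Q j i).tendsto_slope_zero.comp h0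
        simpa [Function.comp_def] using h1
  -- For `s < t` the slope equals `A s` exactly. For `s > t` the increment of `Z` lives on `J s = i`
  -- instead of `J t = i`, an error of at most `K * N s` after division by `s - t`.
  have hdiff : Tendsto (fun s => slope (w i) t s - A s) (𝓝[≠] t) (𝓝 0) := by
    have hKN : Tendsto (fun s => K * N s) (𝓝[≠] t) (𝓝 0) := by
      simpa using (hN0.const_mul K).mono_left nhdsWithin_le_nhds
    refine squeeze_zero_norm' ?_ hKN
    filter_upwards [nhdsWithin_le_nhds hnhds, self_mem_nhdsWithin] with s hs hst
    have hK0 : 0 ≤ K * N s := by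
      obtain ⟨ω, hω⟩ := (hlip s hs).exists
      have h1 : 0 < |s - t| := abs_pos.2 (sub_ne_zero.2 hst)
      have h2 : 0 ≤ K := nonneg_of_mul_nonneg_left ((abs_nonneg _).trans hω) h1
      exact mul_nonneg h2 measureReal_nonneg
    have hsl : ∫ ω in {ω | J t ω = i}, slope (fun s => Z s ω) t s ∂μ =
        (s - t)⁻¹ * ∫ ω in {ω | J t ω = i}, (Z s ω - Z t ω) ∂μ := by
      rw [← integral_const_mul]
      simp [slope_def_field, div_eq_inv_mul]
    rcases lt_or_gt_of_ne hst with h | h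
    · have h1 := hJ.setIntegral_sub_eq (hpos s hs).le h.le i (hZm s (hpos s hs)) (hint s hs)
        (hint t htm)
      have h2 : slope (w i) t s = A s := by
        have h3 : (s - t)⁻¹ = -(t - s)⁻¹ := by rw [← neg_sub, inv_neg]
        have h4 : ∫ ω in {ω | J t ω = i}, (Z s ω - Z t ω) ∂μ =
            -∫ ω in {ω | J t ω = i}, (Z t ω - Z s ω) ∂μ := by
          rw [← integral_neg]
          simp
        rw [slope_def_field, div_eq_inv_mul, ← neg_sub (w i t), h3, neg_mul_neg]
        simp only [hA, hsl, h4, h3, neg_mul_neg, min_eq_left h.le, abs_of_neg (sub_neg.2 h),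
          neg_sub]
        rw [hw]
        simp only
        rw [h1, mul_add, Finset.mul_sum]
        congr 1
        exact Finset.sum_congr rfl fun j _ => by ring
      rw [h2, sub_self, norm_zero]
      exact hK0
    · have h1 := hJ.setIntegral_sub_eq ht0.le h.le i (hZm t ht0) (hint t htm) (hint s hs)
      have h2 := hJ.abs_setIntegral_sub_le (hpos s hs).le ht0.le i
        ((hm s (hpos s hs)).sub (hm t ht0)) (hlip s hs)
      have h3 : slope (w i) t s - A s = (s - t)⁻¹ *
          (∫ ω in {ω | J s ω = i}, (Z s ω - Z t ω) ∂μ -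
            ∫ ω in {ω | J t ω = i}, (Z s ω - Z t ω) ∂μ) := by
        rw [slope_def_field, div_eq_inv_mul]
        simp only [hA, hsl, min_eq_right h.le, abs_of_pos (sub_pos.2 h)]
        rw [hw]
        simp only
        rw [h1, mul_add, Finset.mul_sum, mul_sub]
        have : ∀ x y z z' : ℝ, z = z' → x + z - (y + z') = x - y := by intros; linarith
        refine this _ _ _ _ ?_
        exact Finset.sum_congr rfl fun j _ => by ring
      have h4 : 0 < |s - t| := abs_pos.2 (sub_ne_zero.2 hst)
      rw [h3, norm_mul, norm_inv, Real.norm_eq_abs, Real.norm_eq_abs, inv_mul_le_iff₀ h4]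
      refine h2.trans (le_of_eq ?_)
      ring
  simpa using hdiff.add hAlim

end JumpProcess

/-! ### Partial derivatives under the expectation -/

section Space

variable {d : ℕ} {U : Set (E d)}

theorem fderiv_eq_sum_pd (f : E d → ℝ) (x : E d) :
    fderiv ℝ f x = ∑ j, pd j f x • (EuclideanSpace.proj j : E d →L[ℝ] ℝ) := by
  refine ContinuousLinearMap.coe_injective
    ((EuclideanSpace.basisFun (Fin d) ℝ).toBasis.ext fun k => ?_)
  simp [pd]

theorem pd_congr_of_eqOn (hU : IsOpen U) {f g : E d → ℝ} (h : EqOn f g U) {x : E d} (hx : x ∈ U)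
    (j : Fin d) : pd j f x = pd j g x := by
  unfold pd
  rw [(h.eventuallyEq_of_mem (hU.mem_nhds hx)).fderiv_eq]

theorem contDiffOn_pd (hU : IsOpen U) {f : E d → ℝ} {n : ℕ}
    (hf : ContDiffOn ℝ (n + 1) f U) (j : Fin d) : ContDiffOn ℝ n (pd j f) U :=
  ((contDiffOn_succ_iff_fderiv_of_isOpen hU).1 hf).2.2.clm_apply contDiffOn_const

theorem contDiffOn_succ_of_pd (hU : IsOpen U) {f : E d → ℝ} {n : ℕ}
    (hf : DifferentiableOn ℝ f U) (h : ∀ j, ContDiffOn ℝ n (pd j f) U) :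
    ContDiffOn ℝ (n + 1) f U := by
  refine (contDiffOn_succ_iff_fderiv_of_isOpen hU).2 ⟨hf, by simp, ?_⟩
  have : fderiv ℝ f = fun x => ∑ j, pd j f x • (EuclideanSpace.proj j : E d →L[ℝ] ℝ) :=
    funext (fderiv_eq_sum_pd f)
  rw [this]
  exact ContDiffOn.sum fun j _ => (h j).smul contDiffOn_const

/-- The partial derivative is an almost sure limit of difference quotients along a sequence of steps
that keep the points in `U`. -/
theorem aestronglyMeasurable_pd {Ω : Type*} [MeasurableSpace Ω] {μ : Measure Ω} (hU : IsOpen U)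
    {G : E d → Ω → ℝ} (hG : ∀ y ∈ U, AEStronglyMeasurable (G y) μ) {x : E d} (hx : x ∈ U)
    (hd : ∀ᵐ ω ∂μ, DifferentiableAt ℝ (fun y => G y ω) x) (j : Fin d) :
    AEStronglyMeasurable (fun ω => pd j (fun y => G y ω) x) μ := by
  set e : E d := EuclideanSpace.single j 1
  have hcont : Continuous fun r : ℝ => x + r • e := by fun_prop
  have hnhds : (fun r : ℝ => x + r • e) ⁻¹' U ∈ 𝓝 (0 : ℝ) :=
    hcont.continuousAt.preimage_mem_nhds (by simpa using hU.mem_nhds hx)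
  obtain ⟨c, hc, hcU⟩ := Metric.mem_nhds_iff.1 hnhds
  obtain ⟨r, -, hr, hr0⟩ := exists_seq_strictAnti_tendsto' hc
  have hrU : ∀ n, x + r n • e ∈ U := fun n => hcU (by
    rw [Metric.mem_ball, dist_zero_right, Real.norm_eq_abs, abs_of_pos (hr n).1]
    exact (hr n).2)
  refine aestronglyMeasurable_of_tendsto_ae atTop
    (f := fun n ω => (r n)⁻¹ * (G (x + r n • e) ω - G x ω))
    (fun n => ((hG _ (hrU n)).sub (hG x hx)).const_mul _) ?_
  filter_upwards [hd] with ω hω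
  have h1 := (hω.hasFDerivAt.hasLineDerivAt e).tendsto_slope_zero
  have h2 : Tendsto r atTop (𝓝[≠] 0) :=
    tendsto_nhdsWithin_iff.2 ⟨hr0, Eventually.of_forall fun n => (hr n).1.ne'⟩
  simpa [Function.comp_def, pd, e] using h1.comp h2

/-- A pointwise almost sure bound on a random continuous function is almost surely uniform. -/
theorem ae_forall_abs_le {X Ω : Type*} [TopologicalSpace X] [TopologicalSpace.SeparableSpace X]
    [MeasurableSpace Ω] {μ : Measure Ω} {V : Set X} (hV : IsOpen V) {H : X → Ω → ℝ}
    {K : Ω → ℝ} {p : Ω → Prop} (hc : ∀ᵐ ω ∂μ, ContinuousOn (fun x => H x ω) V)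
    (h : ∀ x ∈ V, ∀ᵐ ω ∂μ, p ω → |H x ω| ≤ K ω) :
    ∀ᵐ ω ∂μ, p ω → ∀ x ∈ V, |H x ω| ≤ K ω := by
  obtain ⟨D, hDc, hD⟩ := TopologicalSpace.exists_countable_dense X
  -- Only countably many null sets are discarded. As `V` is open, `V ∩ D` is dense in it, and
  -- continuity carries the bound over.
  have h1 : ∀ᵐ ω ∂μ, ∀ x ∈ V ∩ D, p ω → |H x ω| ≤ K ω :=
    (ae_ball_iff (hDc.mono inter_subset_right)).2 fun x hx => h x hx.1
  filter_upwards [hc, h1] with ω hω h1ω hp x hx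
  exact ContinuousWithinAt.closure_le (hD.open_subset_closure_inter hV hx)
    ((hω x hx).abs.mono inter_subset_left) continuousWithinAt_const fun y hy => h1ω y hy hp

/-- Differentiation under the integral sign, in terms of partial derivatives. -/
theorem differentiableAt_integral_mul {Ω : Type*} [MeasurableSpace Ω] {μ : Measure Ω}
    [IsFiniteMeasure μ] (hU : IsOpen U) {W : Ω → ℝ} (hW : AEStronglyMeasurable W μ) {B c : ℝ}
    (hB : ∀ᵐ ω ∂μ, |W ω| ≤ B) {G : E d → Ω → ℝ} (hG : ∀ y ∈ U, AEStronglyMeasurable (G y) μ)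
    (hd : ∀ᵐ ω ∂μ, DifferentiableOn ℝ (fun y => G y ω) U)
    (hc : ∀ᵐ ω ∂μ, ∀ y ∈ U, |G y ω| ≤ c)
    (hc' : ∀ᵐ ω ∂μ, ∀ y ∈ U, ∀ j, |pd j (fun y => G y ω) y| ≤ c) {x : E d} (hx : x ∈ U) :
    DifferentiableAt ℝ (fun y => ∫ ω, W ω * G y ω ∂μ) x ∧
      ∀ j, pd j (fun y => ∫ ω, W ω * G y ω ∂μ) x = ∫ ω, W ω * pd j (fun y => G y ω) x ∂μ := by
  have hdx : ∀ᵐ ω ∂μ, ∀ y ∈ U, DifferentiableAt ℝ (fun y => G y ω) y := by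
    filter_upwards [hd] with ω hω y hy
    exact (hω y hy).differentiableAt (hU.mem_nhds hy)
  have hpdm := fun j => aestronglyMeasurable_pd hU hG hx (hdx.mono fun ω hω => hω x hx) j
  have hint : Integrable (fun ω => W ω * G x ω) μ := by
    refine .of_bound (hW.mul (hG x hx)) (B * c) ?_
    filter_upwards [hB, hc] with ω h1 h2
    rw [norm_mul]
    exact mul_le_mul h1 (h2 x hx) (norm_nonneg _) ((abs_nonneg _).trans h1)
  set F' : E d → Ω → E d →L[ℝ] ℝ := fun y ω => W ω • fderiv ℝ (fun y => G y ω) y with hF'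
  set N : ℝ := ∑ j : Fin d, ‖(EuclideanSpace.proj j : E d →L[ℝ] ℝ)‖
  have hF'm : AEStronglyMeasurable (F' x) μ := by
    refine hW.smul ?_
    simp only [fderiv_eq_sum_pd]
    exact Finset.aestronglyMeasurable_fun_sum _ fun j _ => (hpdm j).smul_const _
  have hF'b : ∀ᵐ ω ∂μ, ∀ y ∈ U, ‖F' y ω‖ ≤ B * (c * N) := by
    filter_upwards [hB, hc'] with ω h1 h2 y hy
    rw [hF', norm_smul]
    refine mul_le_mul h1 ?_ (norm_nonneg _) ((abs_nonneg _).trans h1)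
    rw [fderiv_eq_sum_pd, Finset.mul_sum]
    refine norm_sum_le_of_le _ fun j _ => ?_
    rw [norm_smul]
    exact mul_le_mul_of_nonneg_right (h2 y hy j) (norm_nonneg _)
  have hmain : HasFDerivAt (fun y => ∫ ω, W ω * G y ω ∂μ) (∫ ω, F' x ω ∂μ) x := by
    refine hasFDerivAt_integral_of_dominated_of_fderiv_le (hU.mem_nhds hx) ?_ hint hF'm
      hF'b (integrable_const _) ?_
    · filter_upwards [hU.mem_nhds hx] with y hy
      exact hW.mul (hG y hy)
    · filter_upwards [hdx] with ω hω y hy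
      exact (hω y hy).hasFDerivAt.const_mul (W ω)
  refine ⟨hmain.differentiableAt, fun j => ?_⟩
  have hF'i : Integrable (F' x) μ := .of_bound hF'm _ (hF'b.mono fun ω hω => hω x hx)
  unfold pd
  rw [hmain.fderiv, ContinuousLinearMap.integral_apply hF'i]
  simp [hF']

/-- Differentiation under the integral is applied to `G` and again to its first partials; dominated
convergence makes the second partials continuous. In the application `W` holds the event `J t = i`
and the other factors of the moment. -/
theorem contDiffOn_two_integral_mul {Ω : Type*} [MeasurableSpace Ω] {μ : Measure Ω}
    [IsFiniteMeasure μ] (hU : IsOpen U) {W : Ω → ℝ} (hW : AEStronglyMeasurable W μ) {B : ℝ}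
    (hB : ∀ᵐ ω ∂μ, |W ω| ≤ B) {G : E d → Ω → ℝ} (hG : ∀ y ∈ U, AEStronglyMeasurable (G y) μ)
    (hd : ∀ᵐ ω ∂μ, ContDiffOn ℝ 2 (fun y => G y ω) U)
    (hb : ∀ x ∈ U, ∃ V ⊆ U, IsOpen V ∧ x ∈ V ∧ ∃ c, ∀ᵐ ω ∂μ, ∀ y ∈ V, |G y ω| ≤ c ∧
      (∀ j, |pd j (fun y => G y ω) y| ≤ c) ∧ ∀ l j, |pd l (pd j (fun y => G y ω)) y| ≤ c) :
    ContDiffOn ℝ 2 (fun y => ∫ ω, W ω * G y ω ∂μ) U ∧ ∀ x ∈ U,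
      (∀ j, Integrable (fun ω => W ω * pd j (fun y => G y ω) x) μ ∧
        pd j (fun y => ∫ ω, W ω * G y ω ∂μ) x = ∫ ω, W ω * pd j (fun y => G y ω) x ∂μ) ∧
      ∀ l j, Integrable (fun ω => W ω * pd l (pd j (fun y => G y ω)) x) μ ∧
        pd l (pd j (fun y => ∫ ω, W ω * G y ω ∂μ)) x =
          ∫ ω, W ω * pd l (pd j (fun y => G y ω)) x ∂μ := by
  have hd1 : ∀ᵐ ω ∂μ, ∀ j, ContDiffOn ℝ 1 (pd j fun y => G y ω) U := by
    filter_upwards [hd] with ω hω j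
    exact contDiffOn_pd (n := 1) hU hω j
  have hd2 : ∀ᵐ ω ∂μ, ∀ l j, ContinuousOn (pd l (pd j fun y => G y ω)) U := by
    filter_upwards [hd1] with ω hω l j
    exact (contDiffOn_pd (n := 0) hU (by simpa using hω j) l).continuousOn
  have hdiff : ∀ᵐ ω ∂μ, DifferentiableOn ℝ (fun y => G y ω) U :=
    hd.mono fun ω hω => hω.differentiableOn (by simp)
  have hdiff1 : ∀ j, ∀ᵐ ω ∂μ, DifferentiableOn ℝ (pd j fun y => G y ω) U := fun j =>
    hd1.mono fun ω hω => (hω j).differentiableOn (by simp)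
  have hpdm : ∀ j, ∀ x ∈ U, AEStronglyMeasurable (fun ω => pd j (fun y => G y ω) x) μ :=
    fun j x hx => aestronglyMeasurable_pd hU hG hx
      (hdiff.mono fun ω hω => (hω x hx).differentiableAt (hU.mem_nhds hx)) j
  have hpdm2 : ∀ l j, ∀ x ∈ U,
      AEStronglyMeasurable (fun ω => pd l (pd j (fun y => G y ω)) x) μ :=
    fun l j x hx => aestronglyMeasurable_pd hU (hpdm j) hx
      ((hdiff1 j).mono fun ω hω => (hω x hx).differentiableAt (hU.mem_nhds hx)) l
  have h1 : ∀ x ∈ U, DifferentiableAt ℝ (fun y => ∫ ω, W ω * G y ω ∂μ) x ∧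
      ∀ j, pd j (fun y => ∫ ω, W ω * G y ω ∂μ) x = ∫ ω, W ω * pd j (fun y => G y ω) x ∂μ := by
    intro x hx
    obtain ⟨V, hVU, hV, hxV, c, hc⟩ := hb x hx
    exact differentiableAt_integral_mul hV hW hB (fun y hy => hG y (hVU hy))
      (hdiff.mono fun ω hω => hω.mono hVU) (hc.mono fun ω hω y hy => (hω y hy).1)
      (hc.mono fun ω hω y hy => (hω y hy).2.1) hxV
  have h2 : ∀ j, ∀ x ∈ U, DifferentiableAt ℝ (fun y => ∫ ω, W ω * pd j (fun y => G y ω) y ∂μ) x ∧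
      ∀ l, pd l (fun y => ∫ ω, W ω * pd j (fun y => G y ω) y ∂μ) x =
        ∫ ω, W ω * pd l (pd j (fun y => G y ω)) x ∂μ := by
    intro j x hx
    obtain ⟨V, hVU, hV, hxV, c, hc⟩ := hb x hx
    exact differentiableAt_integral_mul hV hW hB (fun y hy => hpdm j y (hVU hy))
      ((hdiff1 j).mono fun ω hω => hω.mono hVU) (hc.mono fun ω hω y hy => (hω y hy).2.1 j)
      (hc.mono fun ω hω y hy l => (hω y hy).2.2 l j) hxV
  have hpd : ∀ j, EqOn (pd j (fun y => ∫ ω, W ω * G y ω ∂μ))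
      (fun y => ∫ ω, W ω * pd j (fun y => G y ω) y ∂μ) U := fun j x hx => (h1 x hx).2 j
  have hpd2 : ∀ l j, EqOn (pd l (pd j (fun y => ∫ ω, W ω * G y ω ∂μ)))
      (fun y => ∫ ω, W ω * pd l (pd j (fun y => G y ω)) y ∂μ) U := fun l j x hx => by
    rw [pd_congr_of_eqOn hU (hpd j) hx]
    exact (h2 j x hx).2 l
  have hWint : ∀ {H : Ω → ℝ} {c : ℝ}, AEStronglyMeasurable H μ → (∀ᵐ ω ∂μ, |H ω| ≤ c) →
      Integrable (fun ω => W ω * H ω) μ := fun {H c} hH hc => by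
    refine .of_bound (hW.mul hH) (B * c) ?_
    filter_upwards [hB, hc] with ω hω1 hω2
    rw [norm_mul]
    exact mul_le_mul hω1 hω2 (norm_nonneg _) ((abs_nonneg _).trans hω1)
  refine ⟨?_, fun x hx => ?_⟩
  rotate_left
  · obtain ⟨V, hVU, hV, hxV, c, hc⟩ := hb x hx
    exact ⟨fun j => ⟨hWint (hpdm j x hx) (hc.mono fun ω hω => (hω x hxV).2.1 j), hpd j hx⟩,
      fun l j => ⟨hWint (hpdm2 l j x hx) (hc.mono fun ω hω => (hω x hxV).2.2 l j), hpd2 l j hx⟩⟩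
  refine contDiffOn_succ_of_pd (n := 1) hU
    (fun x hx => (h1 x hx).1.differentiableWithinAt) fun j => ?_
  refine contDiffOn_succ_of_pd (n := 0) hU (fun x hx => ?_) fun l => ?_
  · exact ((h2 j x hx).1.differentiableWithinAt).congr (hpd j) (hpd j hx)
  · refine contDiffOn_zero.2 (ContinuousOn.congr (fun x hx => ?_) (hpd2 l j))
    obtain ⟨V, hVU, hV, hxV, c, hc⟩ := hb x hx
    refine ContinuousAt.continuousWithinAt (continuousAt_of_dominated (bound := fun _ => B * c)
      ?_ ?_ (integrable_const _) ?_)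
    · filter_upwards [hV.mem_nhds hxV] with y hy
      exact hW.mul (hpdm2 l j y (hVU hy))
    · filter_upwards [hV.mem_nhds hxV] with y hy
      filter_upwards [hB, hc] with ω hω1 hω2
      rw [norm_mul]
      exact mul_le_mul hω1 ((hω2 y hy).2.2 l j) (norm_nonneg _) ((abs_nonneg _).trans hω1)
    · filter_upwards [hd2] with ω hω
      exact continuousAt_const.mul ((hω l j).continuousAt (hU.mem_nhds hx))

end Space

/-! ### Moment variables and bounds on the solution -/

section Moments

/-- Isolating one factor makes the moment linear in `u` in that variable; all spatial statements are
reduced to one variable in this way. -/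
theorem momentVar_eq_mul {Ω I : Type*} {d : ℕ} (J : ℝ → Ω → I) (u : E d → ℝ → Ω → ℝ) {n : ℕ}
    (i : I) (x : Fin (n + 1) → E d) (m : Fin (n + 1)) (t : ℝ) (ω : Ω) :
    momentVar J u i x t ω = momentVar J u i (m.removeNth x) t ω * u (x m) t ω := by
  unfold momentVar
  by_cases h : ω ∈ {ω | J t ω = i}
  · rw [indicator_of_mem h, indicator_of_mem h, Fin.prod_univ_succAbove _ m, mul_comm]
    rfl
  · rw [indicator_of_notMem h, indicator_of_notMem h, zero_mul]

theorem momentVar_update {Ω I : Type*} {d : ℕ} (J : ℝ → Ω → I) (u : E d → ℝ → Ω → ℝ) {n : ℕ}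
    (i : I) (x : Fin (n + 1) → E d) (m : Fin (n + 1)) (y : E d) (t : ℝ) (ω : Ω) :
    momentVar J u i (Function.update x m y) t ω =
      momentVar J u i (m.removeNth x) t ω * u y t ω := by
  rw [momentVar_eq_mul J u i _ m, Fin.removeNth_update, Function.update_self]

theorem prod_erase_eq_prod_removeNth {X : Type*} {n : ℕ} (x : Fin (n + 1) → X) (m : Fin (n + 1))
    (f : X → ℝ) : ∏ k ∈ Finset.univ.erase m, f (x k) = ∏ k, f (m.removeNth x k) := by
  rw [Fin.univ_succAbove _ m, Finset.erase_cons, Finset.prod_map]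
  rfl

variable {Ω I : Type*} [MeasurableSpace Ω] {d : ℕ} {μ : Measure Ω}
  {P : Data I d} {J : ℝ → Ω → I} {u : E d → ℝ → Ω → ℝ}

/-- On compact subsets of `U × (0, ∞)`, the solution, its derivatives and its images under the
operators are bounded by a constant. -/
theorem IsSolution.exists_bound [Finite I] [Nonempty I] (hu : IsSolution μ P J u)
    {K : Set (E d × ℝ)} (hK : IsCompact K) (hKU : K ⊆ P.U ×ˢ Ioi (0 : ℝ)) :
    ∃ c, 0 ≤ c ∧ ∀ x t, (x, t) ∈ K → ∀ᵐ ω ∂μ, |u x t ω| ≤ c ∧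
      (∀ j, |pd j (fun y => u y t ω) x| ≤ c) ∧
      (∀ l j, |pd l (pd j (fun y => u y t ω)) x| ≤ c) ∧
      ∀ i, |P.L i (fun y => u y t ω) x| ≤ c := by
  obtain ⟨C, hC, hb⟩ := hu.interior_bound
  obtain ⟨c, hc⟩ := (hC K hKU hK).exists_norm_le
  refine ⟨max c 0, le_max_right _ _, fun x t hxt => ?_⟩
  have hCc : C (x, t) ≤ max c 0 :=
    (le_abs_self _).trans ((hc _ (mem_image_of_mem C hxt)).trans (le_max_left _ _))
  have h := ae_all_iff.2 (hb x (hKU hxt).1 t (hKU hxt).2)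
  filter_upwards [h] with ω hω
  -- In each weight `|a| + 1` of the interior bound, `|a|` controls the term of the operator and `1`
  -- the derivative itself.
  have key : ∀ i, |u x t ω| ≤ C (x, t) ∧
      (∀ j, |pd j (fun y => u y t ω) x| ≤ C (x, t)) ∧
      (∀ l j, |pd l (pd j (fun y => u y t ω)) x| ≤ C (x, t)) ∧
      |P.L i (fun y => u y t ω) x| ≤ C (x, t) := by
    intro i
    have hi := hω i
    set S₁ := ∑ j, (|P.b i x j| + 1) * |pd j (fun y => u y t ω) x| with hS₁
    set S₂ := ∑ l, ∑ j, (|(P.σ i x * (P.σ i x).transpose) l j| + 1)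
          * |pd l (pd j (fun y => u y t ω)) x| with hS₂
    have hpos : ∀ a b : ℝ, 0 ≤ (|a| + 1) * |b| := fun a b => by positivity
    have hle : ∀ a b : ℝ, |b| ≤ (|a| + 1) * |b| := fun a b =>
      le_mul_of_one_le_left (abs_nonneg _) (by linarith [abs_nonneg a])
    have hle' : ∀ a b : ℝ, |a * b| ≤ (|a| + 1) * |b| := fun a b => by
      rw [abs_mul]
      exact mul_le_mul_of_nonneg_right (by linarith) (abs_nonneg _)
    have h1 : 0 ≤ S₁ := Finset.sum_nonneg fun j _ => hpos _ _
    have h2 : 0 ≤ S₂ := Finset.sum_nonneg fun l _ => Finset.sum_nonneg fun j _ => hpos _ _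
    have h3 := hpos (P.s i x) (u x t ω)
    refine ⟨?_, fun j => ?_, fun l j => ?_, ?_⟩
    · linarith [hle (P.s i x) (u x t ω)]
    · have := Finset.single_le_sum (f := fun j => (|P.b i x j| + 1) * |pd j (fun y => u y t ω) x|)
        (fun j _ => hpos _ _) (Finset.mem_univ j)
      have := hle (P.b i x j) (pd j (fun y => u y t ω) x)
      linarith
    · have h4 := Finset.single_le_sum
        (f := fun j => (|(P.σ i x * (P.σ i x).transpose) l j| + 1)
          * |pd l (pd j (fun y => u y t ω)) x|) (fun j _ => hpos _ _) (Finset.mem_univ j)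
      have h5 := Finset.single_le_sum
        (f := fun l => ∑ j, (|(P.σ i x * (P.σ i x).transpose) l j| + 1)
          * |pd l (pd j (fun y => u y t ω)) x|)
        (fun l _ => Finset.sum_nonneg fun j _ => hpos _ _) (Finset.mem_univ l)
      have h6 := hle ((P.σ i x * (P.σ i x).transpose) l j) (pd l (pd j (fun y => u y t ω)) x)
      linarith
    · have h4 : |∑ j, P.b i x j * pd j (fun y => u y t ω) x| ≤ S₁ :=
        (Finset.abs_sum_le_sum_abs _ _).trans (Finset.sum_le_sum fun j _ => hle' _ _)
      have h5 : |∑ l, ∑ j, (P.σ i x * (P.σ i x).transpose) l j *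
          pd l (pd j (fun y => u y t ω)) x| ≤ S₂ :=
        (Finset.abs_sum_le_sum_abs _ _).trans (Finset.sum_le_sum fun l _ =>
          (Finset.abs_sum_le_sum_abs _ _).trans (Finset.sum_le_sum fun j _ => hle' _ _))
      have h6 := hle' (P.s i x) (u x t ω)
      rw [Data.L]
      rw [abs_le] at h4 h5 h6 ⊢
      constructor <;> linarith [h4.1, h4.2, h5.1, h5.2, h6.1, h6.2]
  obtain ⟨i₀⟩ := ‹Nonempty I›
  exact ⟨(key i₀).1.trans hCc, fun j => ((key i₀).2.1 j).trans hCc,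
    fun l j => ((key i₀).2.2.1 l j).trans hCc, fun i => (key i).2.2.2.trans hCc⟩

theorem IsSolution.exists_bound_at [Finite I] [Nonempty I] (hu : IsSolution μ P J u) {x : E d}
    (hx : x ∈ P.U) {t : ℝ} (ht : 0 < t) : ∃ c, ∀ᵐ ω ∂μ, |u x t ω| ≤ c := by
  obtain ⟨c, -, hc⟩ := hu.exists_bound (K := {(x, t)}) isCompact_singleton (by simp [hx, ht])
  exact ⟨c, (hc x t rfl).mono fun ω hω => hω.1⟩

/-- Near an interior point, the solution and its derivatives are almost surely uniformly bounded
by a constant. -/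
theorem IsSolution.exists_local_bound [Finite I] [Nonempty I] (hu : IsSolution μ P J u) {x : E d}
    (hx : x ∈ P.U) {t : ℝ} (ht : 0 < t) :
    ∃ V ⊆ P.U, IsOpen V ∧ x ∈ V ∧ ∃ c, ∀ᵐ ω ∂μ, ∀ y ∈ V, |u y t ω| ≤ c ∧
      (∀ j, |pd j (fun y => u y t ω) y| ≤ c) ∧
      ∀ l j, |pd l (pd j (fun y => u y t ω)) y| ≤ c := by
  obtain ⟨r, hr, hrU⟩ := Metric.nhds_basis_closedBall.mem_iff.1 (P.isOpen_U.mem_nhds hx)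
  obtain ⟨c, -, hc⟩ := hu.exists_bound (K := Metric.closedBall x r ×ˢ {t})
    ((isCompact_closedBall x r).prod isCompact_singleton)
    (prod_mono hrU (by simpa using ht))
  have hsub : Metric.ball x r ⊆ P.U := Metric.ball_subset_closedBall.trans hrU
  have hc' : ∀ y ∈ Metric.ball x r, _ := fun y hy =>
    hc y t ⟨Metric.ball_subset_closedBall hy, rfl⟩
  have hcd1 : ∀ᵐ ω ∂μ, ∀ j, ContDiffOn ℝ 1 (pd j fun y => u y t ω) P.U := by
    filter_upwards [hu.contDiff_space t ht] with ω hω j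
    exact contDiffOn_pd (n := 1) P.isOpen_U hω.1 j
  have h0 := ae_forall_abs_le (μ := μ) (p := fun _ => True) (K := fun _ => c)
    (H := fun y ω => u y t ω) Metric.isOpen_ball
    ((hu.contDiff_space t ht).mono fun ω hω => hω.1.continuousOn.mono hsub)
    (fun y hy => (hc' y hy).mono fun ω hω _ => hω.1)
  have h1 := fun j => ae_forall_abs_le (μ := μ) (p := fun _ => True) (K := fun _ => c)
    (H := fun y ω => pd j (fun y => u y t ω) y) Metric.isOpen_ball
    (hcd1.mono fun ω hω => (hω j).continuousOn.mono hsub)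
    (fun y hy => (hc' y hy).mono fun ω hω _ => hω.2.1 j)
  have h2 := fun l j => ae_forall_abs_le (μ := μ) (p := fun _ => True) (K := fun _ => c)
    (H := fun y ω => pd l (pd j (fun y => u y t ω)) y) Metric.isOpen_ball
    (hcd1.mono fun ω hω =>
      (contDiffOn_pd (n := 0) P.isOpen_U (by simpa using hω j) l).continuousOn.mono hsub)
    (fun y hy => (hc' y hy).mono fun ω hω _ => hω.2.2.1 l j)
  refine ⟨Metric.ball x r, hsub, Metric.isOpen_ball, Metric.mem_ball_self hr, c, ?_⟩
  have h1' := ae_all_iff.2 h1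
  have h2' := ae_all_iff.2 fun l => ae_all_iff.2 (h2 l)
  filter_upwards [h0, h1', h2'] with ω hω0 hω1 hω2 y hy
  exact ⟨hω0 trivial y hy, fun j => hω1 j trivial y hy, fun l j => hω2 l j trivial y hy⟩

theorem IsSolution.aestronglyMeasurable [Fintype I] [DecidableEq I] {Q : Matrix I I ℝ}
    (hJ : IsMarkovJumpProcess μ Q J) (hu : IsSolution μ P J u) {t : ℝ} (ht : 0 < t) {x : E d}
    (hx : x ∈ closure P.U) : AEStronglyMeasurable (u x t) μ :=
  (hu.adapted t ht.le x hx).mono (hJ.past_le t)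

theorem IsSolution.aestronglyMeasurable_momentVar [Fintype I] [DecidableEq I] {Q : Matrix I I ℝ}
    (hJ : IsMarkovJumpProcess μ Q J) (hu : IsSolution μ P J u) {M : ℕ} (i : I) {t : ℝ}
    (ht : 0 < t) {x : Fin M → E d} (hx : ∀ m, x m ∈ closure P.U) :
    AEStronglyMeasurable (momentVar J u i x t) μ :=
  (Finset.aestronglyMeasurable_fun_prod _ fun m _ =>
    hu.aestronglyMeasurable hJ ht (hx m)).indicator (hJ.measurable t ht.le i)

theorem IsSolution.exists_bound_momentVar [Finite I] [Nonempty I] (hu : IsSolution μ P J u)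
    {M : ℕ} (i : I) {t : ℝ} (ht : 0 < t) {x : Fin M → E d} (hx : ∀ m, x m ∈ P.U) :
    ∃ B, ∀ᵐ ω ∂μ, |momentVar J u i x t ω| ≤ B := by
  choose c hc using fun m => hu.exists_bound_at (hx m) ht
  refine ⟨∏ m, c m, ?_⟩
  filter_upwards [ae_all_iff.2 hc] with ω hω
  have h : |∏ m, u (x m) t ω| ≤ ∏ m, c m := by
    rw [Finset.abs_prod]
    exact Finset.prod_le_prod (fun m _ => abs_nonneg _) fun m _ => hω m
  exact (norm_indicator_le_norm_self (fun ω => ∏ m, u (x m) t ω) ω).trans h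

end Moments

/-- The σ-algebra `m` need not be the one carrying the measure, so that products of adapted factors
remain adapted. -/
theorem aestronglyMeasurable_finset_prod {Ω ι : Type*} [Fintype ι] {m m₀ : MeasurableSpace Ω}
    {μ : Measure[m₀] Ω} {f : ι → Ω → ℝ} (hf : ∀ k, AEStronglyMeasurable[m] (f k) μ) :
    AEStronglyMeasurable[m] (fun ω => ∏ k, f k ω) μ := by
  choose g hg hfg using hf
  refine ⟨fun ω => ∏ k, g k ω, Finset.stronglyMeasurable_fun_prod _ fun k _ => hg k, ?_⟩
  filter_upwards [ae_all_iff.2 hfg] with ω hω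
  exact Finset.prod_congr rfl fun k _ => hω k

/-! ### The moment equation in the interior -/

section Interior

theorem v_eq_setIntegral {Ω I : Type*} [MeasurableSpace Ω] [Fintype I] [DecidableEq I] {d : ℕ}
    {μ : Measure Ω} {Q : Matrix I I ℝ} {J : ℝ → Ω → I} {u : E d → ℝ → Ω → ℝ}
    (hJ : IsMarkovJumpProcess μ Q J) {M : ℕ} (i : I) (x : Fin M → E d)
    {t : ℝ} (ht : 0 ≤ t) : v μ J u i x t = ∫ ω in {ω | J t ω = i}, ∏ m, u (x m) t ω ∂μ :=
  integral_indicator (hJ.measurable t ht i)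

/-- The product rule for the product of the values of the solution at several points. -/
theorem hasDerivAt_prod_solution {Ω I : Type*} {d : ℕ} {P : Data I d} {J : ℝ → Ω → I}
    {u : E d → ℝ → Ω → ℝ} {n : ℕ} {x : Fin (n + 1) → E d} {ω : Ω} {t : ℝ}
    (h : ∀ m, HasDerivAt (fun τ => u (x m) τ ω) (P.L (J t ω) (fun y => u y t ω) (x m)) t) :
    HasDerivAt (fun τ => ∏ m, u (x m) τ ω)
      (∑ m, (∏ k, u (m.removeNth x k) t ω) * P.L (J t ω) (fun y => u y t ω) (x m)) t := by
  have h1 := HasDerivAt.fun_finsetProd (u := Finset.univ) fun m _ => h m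
  refine h1.congr_deriv (Finset.sum_congr rfl fun m _ => ?_)
  rw [smul_eq_mul, prod_erase_eq_prod_removeNth x m fun y => u y t ω]
variable {Ω I : Type*} [MeasurableSpace Ω] [Fintype I] [DecidableEq I] {d : ℕ} {μ : Measure Ω}
  [IsProbabilityMeasure μ] {Q : Matrix I I ℝ} {P : Data I d} {J : ℝ → Ω → I}
  {u : E d → ℝ → Ω → ℝ}

theorem IsSolution.contDiffOn_two_integral_mul [Nonempty I]
    (hJ : IsMarkovJumpProcess μ Q J) (hu : IsSolution μ P J u) {t : ℝ} (ht : 0 < t) {W : Ω → ℝ}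
    (hW : AEStronglyMeasurable W μ) {B : ℝ} (hB : ∀ᵐ ω ∂μ, |W ω| ≤ B) :
    ContDiffOn ℝ 2 (fun y => ∫ ω, W ω * u y t ω ∂μ) P.U ∧ ∀ x ∈ P.U, ∀ i,
      Integrable (fun ω => W ω * P.L i (fun y => u y t ω) x) μ ∧
      P.L i (fun y => ∫ ω, W ω * u y t ω ∂μ) x = ∫ ω, W ω * P.L i (fun y => u y t ω) x ∂μ := by
  obtain ⟨h1, h2⟩ := SwitchingPDE.contDiffOn_two_integral_mul P.isOpen_U hW hB
    (G := fun y ω => u y t ω) (fun y hy => hu.aestronglyMeasurable hJ ht (subset_closure hy))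
    ((hu.contDiff_space t ht).mono fun ω hω => hω.1)
    (fun x hx => hu.exists_local_bound hx ht)
  refine ⟨h1, fun x hx i => ?_⟩
  obtain ⟨h3, h4⟩ := h2 x hx
  obtain ⟨c, hc⟩ := hu.exists_bound_at hx ht
  have h5 : Integrable (fun ω => W ω * u x t ω) μ := by
    refine .of_bound (hW.mul (hu.aestronglyMeasurable hJ ht (subset_closure hx))) (B * c) ?_
    filter_upwards [hB, hc] with ω hω1 hω2
    rw [norm_mul]
    exact mul_le_mul hω1 hω2 (norm_nonneg _) ((abs_nonneg _).trans hω1)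
  have h6 : (fun ω => W ω * P.L i (fun y => u y t ω) x) = fun ω =>
      ∑ j, P.b i x j * (W ω * pd j (fun y => u y t ω) x)
      + (1 / 2) * ∑ l, ∑ j, (P.σ i x * (P.σ i x).transpose) l j *
        (W ω * pd l (pd j (fun y => u y t ω)) x)
      + P.s i x * (W ω * u x t ω) := by
    funext ω
    rw [Data.L, mul_add, mul_add, mul_left_comm _ (1 / 2 : ℝ)]
    simp only [Finset.mul_sum]
    congr 1
    · congr 1
      · exact Finset.sum_congr rfl fun j _ => by ring
      · exact Finset.sum_congr rfl fun l _ => Finset.sum_congr rfl fun j _ => by ring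
    · ring
  have h7 : Integrable (fun ω => ∑ j, P.b i x j * (W ω * pd j (fun y => u y t ω) x)) μ :=
    integrable_finsetSum _ fun j _ => (h3 j).1.const_mul _
  have h8 : ∀ l, Integrable (fun ω => ∑ j, (P.σ i x * (P.σ i x).transpose) l j *
      (W ω * pd l (pd j (fun y => u y t ω)) x)) μ := fun l =>
    integrable_finsetSum _ fun j _ => (h4 l j).1.const_mul _
  have h9 : Integrable (fun ω => (1 / 2) * ∑ l, ∑ j, (P.σ i x * (P.σ i x).transpose) l j *
      (W ω * pd l (pd j (fun y => u y t ω)) x)) μ :=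
    (integrable_finsetSum _ fun l _ => h8 l).const_mul _
  rw [h6]
  refine ⟨(h7.add h9).add (h5.const_mul _), ?_⟩
  have h10 : ∀ f g h : Ω → ℝ, Integrable f μ → Integrable g μ → Integrable h μ →
      ∫ ω, (f ω + g ω + h ω) ∂μ = ∫ ω, f ω ∂μ + ∫ ω, g ω ∂μ + ∫ ω, h ω ∂μ :=
    fun f g h hf hg hh => (integral_add (hf.add hg) hh).trans
      (congrArg (· + ∫ ω, h ω ∂μ) (integral_add hf hg))
  rw [h10 _ _ _ h7 h9 (h5.const_mul _), integral_const_mul,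
    integral_const_mul, integral_finsetSum _ fun j _ => (h3 j).1.const_mul _,
    integral_finsetSum _ fun l _ => h8 l, Data.L]
  congr 1
  congr 1
  · exact Finset.sum_congr rfl fun j _ => by rw [integral_const_mul, (h3 j).2]
  · congr 1
    refine Finset.sum_congr rfl fun l _ => ?_
    rw [integral_finsetSum _ fun j _ => (h4 l j).1.const_mul _]
    exact Finset.sum_congr rfl fun j _ => by rw [integral_const_mul, (h4 l j).2]

/-- The moments satisfy the moment equation in the interior. -/
theorem IsSolution.hasDerivAt_v [Nonempty I] (hJ : IsMarkovJumpProcess μ Q J)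
    (hu : IsSolution μ P J u) {n : ℕ} (i : I) {t : ℝ} {x : Fin (n + 1) → E d} (ht : 0 < t)
    (hx : ∀ m, x m ∈ P.U) :
    HasDerivAt (fun τ => v μ J u i x τ)
      (∑ m, P.L i (fun y => v μ J u i (Function.update x m y) t) (x m)
        + ∑ j, Q j i * v μ J u j x t) t := by
  set Z : ℝ → Ω → ℝ := fun s ω => ∏ m, u (x m) s ω with hZ
  set Z' : ℝ → Ω → ℝ := fun s ω =>
    ∑ m, (∏ k, u (m.removeNth x k) s ω) * P.L (J s ω) (fun y => u y s ω) (x m) with hZ'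
  have ha : 0 < t / 2 := by positivity
  have hpos : ∀ s ∈ Icc (t / 2) (2 * t), 0 < s := fun s hs => ha.trans_le hs.1
  obtain ⟨c, hc0, hc⟩ := hu.exists_bound (K := range x ×ˢ Icc (t / 2) (2 * t))
    ((finite_range x).isCompact.prod isCompact_Icc)
    (prod_mono (range_subset_iff.2 hx) hpos)
  have hcx : ∀ s ∈ Icc (t / 2) (2 * t), ∀ᵐ ω ∂μ, ∀ m, |u (x m) s ω| ≤ c ∧
      ∀ i, |P.L i (fun y => u y s ω) (x m)| ≤ c := fun s hs => by
    rw [ae_all_iff]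
    intro m
    filter_upwards [hc (x m) s ⟨mem_range_self m, hs⟩] with ω hω
    exact ⟨hω.1, hω.2.2.2⟩
  have hderiv : ∀ s, 0 < s → ∀ᵐ ω ∂μ, HasDerivAt (fun τ => Z τ ω) (Z' s ω) s := by
    intro s hs
    filter_upwards [hJ.ae_noJumpAt hs, ae_all_iff.2 fun m => hu.pde (x m) (hx m)] with ω h1 h2
    exact hasDerivAt_prod_solution fun m => h2 m s hs h1
  have hcont : ∀ᵐ ω ∂μ, ContinuousOn (fun s => Z s ω) (Ioi 0) := by
    filter_upwards [ae_all_iff.2 fun m => hu.continuous_time (x m) (hx m)] with ω hω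
    exact continuousOn_finsetProd _ fun m _ => hω m
  have hcount : ∀ᵐ ω ∂μ, {s | 0 < s ∧ ¬ DifferentiableAt ℝ (fun s => Z s ω) s}.Countable := by
    filter_upwards [hJ.ae_countable_jumps, ae_all_iff.2 fun m => hu.pde (x m) (hx m)] with ω h1 h2
    refine Countable.mono (fun s hs => mem_ofPred.2 ⟨hs.1, fun hns => hs.2 ?_⟩) h1
    exact (hasDerivAt_prod_solution fun m => h2 m s hs.1 hns).differentiableAt
  have hZm : ∀ s, 0 < s → AEStronglyMeasurable[past J s] (Z s) μ := fun s hs =>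
    aestronglyMeasurable_finset_prod fun m => hu.adapted s hs.le (x m) (subset_closure (hx m))
  have hZm' : ∀ s, 0 < s → AEStronglyMeasurable (Z s) μ := fun s hs => (hZm s hs).mono (hJ.past_le s)
  -- The product rule gives `n + 1` terms, each with `n` values of `u` and one value of the
  -- operator, all bounded by `c` on the time window from `t / 2` to `2 * t`.
  have hlip := ae_lipschitz_of_ae_abs_deriv_le (K := ∑ _m : Fin (n + 1), c ^ n * c) hZm' hcont
    hcount ha (by positivity) (b := 2 * t) (fun s hs => by
      filter_upwards [hderiv s (hpos s hs), hcx s hs] with ω h1 h2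
      refine ⟨h1.differentiableAt, ?_⟩
      rw [h1.deriv]
      refine (Finset.abs_sum_le_sum_abs _ _).trans (Finset.sum_le_sum fun m _ => ?_)
      rw [abs_mul, Finset.abs_prod]
      refine mul_le_mul ?_ ((h2 m).2 _) (abs_nonneg _) (by positivity)
      refine (Finset.prod_le_prod (fun k _ => abs_nonneg _)
        fun k _ => (h2 (m.succAbove k)).1).trans ?_
      simp)
  have hbd : ∀ s ∈ Icc (t / 2) (2 * t), ∀ᵐ ω ∂μ, |Z s ω| ≤ c ^ (n + 1) := fun s hs => by
    filter_upwards [hcx s hs] with ω h2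
    rw [hZ, Finset.abs_prod]
    refine (Finset.prod_le_prod (fun k _ => abs_nonneg _) fun k _ => (h2 k).1).trans ?_
    simp
  have hmain := hJ.hasDerivAt_setIntegral ha (by linarith) (by linarith : t < 2 * t) hZm hbd hlip
    (hderiv t ht) i
  have hev : (fun τ => v μ J u i x τ) =ᶠ[𝓝 t] fun s => ∫ ω in {ω | J s ω = i}, Z s ω ∂μ := by
    filter_upwards [Ioi_mem_nhds ht] with s hs
    exact v_eq_setIntegral hJ i x (le_of_lt hs)
  refine (hmain.congr_of_eventuallyEq hev).congr_deriv ?_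
  congr 1
  · have hL : ∀ m, Integrable (fun ω => momentVar J u i (m.removeNth x) t ω *
        P.L i (fun y => u y t ω) (x m)) μ ∧
        P.L i (fun y => v μ J u i (Function.update x m y) t) (x m) =
        ∫ ω, momentVar J u i (m.removeNth x) t ω * P.L i (fun y => u y t ω) (x m) ∂μ := by
      intro m
      obtain ⟨B, hB⟩ := hu.exists_bound_momentVar i ht (x := m.removeNth x) fun k => hx _
      have h := (hu.contDiffOn_two_integral_mul hJ ht
        (hu.aestronglyMeasurable_momentVar hJ i ht fun k => subset_closure (hx _)) hB).2
        (x m) (hx m) i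
      refine ⟨h.1, ?_⟩
      simp only [v, momentVar_update]
      exact h.2
    rw [Finset.sum_congr rfl fun m _ => (hL m).2, ← integral_finsetSum _ fun m _ => (hL m).1,
      ← integral_indicator (hJ.measurable t ht.le i)]
    -- On the event `J t = i` the random operator in `Z'` is the `i`-th one; elsewhere both sides
    -- vanish.
    refine integral_congr_ae (Eventually.of_forall fun ω => ?_)
    by_cases h : J t ω = i
    · simp [momentVar, hZ', h]
    · simp [momentVar, h]
  · exact Finset.sum_congr rfl fun j _ => by rw [v_eq_setIntegral hJ j x ht.le]

theorem IsSolution.integrable_momentVar [Nonempty I] (hJ : IsMarkovJumpProcess μ Q J)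
    (hu : IsSolution μ P J u) {M : ℕ} (i : I) {t : ℝ} {x : Fin M → E d} (ht : 0 < t)
    (hx : ∀ m, x m ∈ P.U) : Integrable (momentVar J u i x t) μ := by
  obtain ⟨B, hB⟩ := hu.exists_bound_momentVar i ht hx
  exact .of_bound (hu.aestronglyMeasurable_momentVar hJ i ht fun k => subset_closure (hx k)) B hB

theorem IsSolution.contDiffOn_v [Nonempty I] (hJ : IsMarkovJumpProcess μ Q J)
    (hu : IsSolution μ P J u) {n : ℕ} (i : I) {t : ℝ} {x : Fin (n + 1) → E d} (ht : 0 < t)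
    (hx : ∀ m, x m ∈ P.U) (m : Fin (n + 1)) :
    ContDiffOn ℝ 2 (fun y => v μ J u i (Function.update x m y) t) P.U := by
  obtain ⟨B, hB⟩ := hu.exists_bound_momentVar i ht (x := m.removeNth x) fun k => hx _
  have h := (hu.contDiffOn_two_integral_mul hJ ht
    (hu.aestronglyMeasurable_momentVar hJ i ht fun k => subset_closure (hx _)) hB).1
  simp only [v, momentVar_update]
  exact h

end Interior

/-! ### Integrability and normal derivatives at the boundary -/

section Boundary

theorem momentVar_of_ne {Ω I : Type*} {d M : ℕ} (J : ℝ → Ω → I) (u : E d → ℝ → Ω → ℝ)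
    {i : I} (x : Fin M → E d) {t : ℝ} {ω : Ω} (hi : J t ω ≠ i) : momentVar J u i x t ω = 0 :=
  indicator_of_notMem (s := {ω | J t ω = i}) hi _

theorem IsOutwardUnitNormal.exists_segment {d : ℕ} {U B : Set (E d)} {x n : E d}
    (hn : IsOutwardUnitNormal U x n) (hB : B ∈ 𝓝 x) :
    ∃ ε > 0, ∀ r ∈ Ico (-ε) (0 : ℝ), x + r • n ∈ U ∩ B := by
  have hcont : Continuous fun r : ℝ => x + r • n := by fun_prop
  have h0 : Tendsto (fun r : ℝ => x + r • n) (𝓝 0) (𝓝 x) := by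
    simpa using hcont.tendsto 0
  obtain ⟨ε, hε, h⟩ := Metric.eventually_nhds_iff.1
    (h0.eventually ((hn.2 (1 / 2) (by norm_num)).and hB))
  refine ⟨ε / 2, by positivity, fun r hr => ?_⟩
  have hrε : dist r 0 < ε := by
    rw [dist_zero_right, Real.norm_eq_abs, abs_of_neg hr.2]
    linarith [hr.1]
  -- For `r < 0` the inner product of `r • n` with `n` is `-|r|`, which is below `-c * |r|` for any
  -- `c < 1`; hence the choice `1 / 2`.
  refine ⟨(h hrε).1.1 ?_, (h hrε).2⟩
  rw [add_sub_cancel_left, real_inner_smul_left, real_inner_self_eq_norm_sq, norm_smul, hn.1,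
    Real.norm_eq_abs, abs_of_neg hr.2]
  linarith [hr.2]

theorem hasNormalDeriv_iff_tendsto {d : ℕ} {f : E d → ℝ} {x n : E d} {D : ℝ} :
    HasNormalDeriv f x n D ↔ Tendsto (fun r : ℝ => r⁻¹ * (f (x + r • n) - f x)) (𝓝[<] 0) (𝓝 D) := by
  rw [HasNormalDeriv, ← hasDerivWithinAt_Iio_iff_Iic, hasDerivWithinAt_iff_tendsto_slope' (by simp)]
  simp [slope_fun_def]

variable {Ω I : Type*} [MeasurableSpace Ω] {d : ℕ} {μ : Measure Ω}
  {P : Data I d} {J : ℝ → Ω → I} {u : E d → ℝ → Ω → ℝ}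

theorem Data.frontier_of_mem (P : Data I d) {i : I} {x : E d} (hx : x ∈ P.ΓNeu i ∪ P.ΓRob i) :
    x ∈ frontier P.U := by
  rw [← P.boundary_eq i]
  rcases hx with h | h
  · exact Or.inl (Or.inr h)
  · exact Or.inr h

/-- Along the normal line at a Neumann or Robin point, the solution is Lipschitz with an
integrable constant. -/
theorem IsSolution.exists_normal_increment_bound (hu : IsSolution μ P J u) {i : I} {t : ℝ}
    (ht : 0 < t) {x : E d} (hx : x ∈ P.ΓNeu i ∪ P.ΓRob i) :
    ∃ ε > 0, ∃ c : Ω → ℝ, Integrable c μ ∧ (∀ r ∈ Ico (-ε) (0 : ℝ), x + r • P.n x ∈ P.U) ∧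
      ∀ᵐ ω ∂μ, J t ω = i → ∀ r ∈ Icc (-ε) (0 : ℝ),
        |u x t ω - u (x + r • P.n x) t ω| ≤ c ω * |r| := by
  obtain ⟨C, B, -, hC, hB, hbd⟩ := hu.boundary_bound t ht i
  have hn := P.isNormal i x hx
  have hBx : interior B ∈ 𝓝 x := interior_mem_nhds.2 (nhds_le_nhdsSet hx hB)
  obtain ⟨ε, hε, hseg⟩ := hn.exists_segment hBx
  have hxU : x ∈ closure P.U := frontier_subset_closure (P.frontier_of_mem hx)
  have hpd : ∀ᵐ ω ∂μ, ∀ j, J t ω = i → ∀ y ∈ P.U ∩ interior B,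
      |pd j (fun y => u y t ω) y| ≤ C ω := by
    rw [ae_all_iff]
    refine fun j => ae_forall_abs_le (P.isOpen_U.inter isOpen_interior) ?_ fun y hy =>
      hbd j y ⟨interior_subset hy.2, hy.1⟩
    filter_upwards [hu.contDiff_space t ht] with ω hω
    exact (contDiffOn_pd (n := 1) P.isOpen_U hω.1 j).continuousOn.mono inter_subset_left
  -- The directional derivative along the normal is a sum of `d` partials, each bounded by `C ω`,
  -- with coefficients of size at most `1`. Continuity up to the closure lets the mean value
  -- inequality reach the endpoint `r = 0`.
  refine ⟨ε, hε, fun ω => d * C ω, hC.const_mul _, fun r hr => (hseg r hr).1, ?_⟩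
  filter_upwards [hu.contDiff_space t ht, hpd] with ω hω1 hω2 hωi r hr
  have hcl : ∀ s ∈ Icc r 0, x + s • P.n x ∈ closure P.U := by
    intro s hs
    rcases hs.2.eq_or_lt with rfl | hs0
    · simpa using hxU
    · exact subset_closure (hseg s ⟨hr.1.trans hs.1, hs0⟩).1
  have hcont : ContinuousOn (fun s : ℝ => u (x + s • P.n x) t ω) (Icc r 0) :=
    hω1.2.1.comp (by fun_prop) hcl
  have hder : ∀ s ∈ Ico r 0, HasDerivWithinAt (fun s : ℝ => u (x + s • P.n x) t ω)
      (fderiv ℝ (fun y => u y t ω) (x + s • P.n x) (P.n x)) (Ici s) s := by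
    intro s hs
    have hsU := (hseg s ⟨hr.1.trans hs.1, hs.2⟩).1
    have hd : DifferentiableAt ℝ (fun y => u y t ω) (x + s • P.n x) :=
      (hω1.1.differentiableOn (by simp) _ hsU).differentiableAt (P.isOpen_U.mem_nhds hsU)
    have hline : HasDerivAt (fun s : ℝ => x + s • P.n x) (P.n x) s := by
      simpa using ((hasDerivAt_id s).smul_const (P.n x)).const_add x
    exact (hd.hasFDerivAt.comp_hasDerivAt s hline).hasDerivWithinAt
  have hbound : ∀ s ∈ Ico r 0,
      ‖fderiv ℝ (fun y => u y t ω) (x + s • P.n x) (P.n x)‖ ≤ d * C ω := by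
    intro s hs
    have hs' := hseg s ⟨hr.1.trans hs.1, hs.2⟩
    rw [fderiv_eq_sum_pd, _root_.sum_apply]
    refine (norm_sum_le_of_le (f := fun j => _) (n := fun _ => C ω) Finset.univ fun j _ => ?_).trans
      (by simp)
    have h1 := hω2 j hωi _ hs'
    have h2 : |P.n x j| ≤ 1 := by
      simpa [hn.1] using PiLp.norm_apply_le (P.n x) j
    rw [_root_.smul_apply, norm_smul, ← mul_one (C ω)]
    exact mul_le_mul h1 h2 (abs_nonneg _) ((abs_nonneg _).trans h1)
  have hmvt := norm_image_sub_le_of_norm_deriv_right_le_segment hcont hder hbound 0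
    (right_mem_Icc.2 hr.2)
  rw [abs_of_nonpos hr.2]
  simpa using hmvt

/-- The interior bound does not reach the boundary. At a Dirichlet point the value is deterministic;
at a Neumann or Robin point one steps inward along the normal, where the value is bounded, and adds
the increment bound. -/
theorem IsSolution.exists_integrable_bound_frontier [Finite I] [IsProbabilityMeasure μ]
    (hu : IsSolution μ P J u) {i : I} {t : ℝ} (ht : 0 < t) {x : E d} (hx : x ∈ frontier P.U) :
    ∃ c : Ω → ℝ, Integrable c μ ∧ ∀ᵐ ω ∂μ, J t ω = i → |u x t ω| ≤ c ω := by
  have : Nonempty I := ⟨i⟩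
  by_cases hD : x ∈ P.ΓDir i
  · refine ⟨fun _ => |P.gDir i x|, integrable_const _, ?_⟩
    filter_upwards [hu.dirichlet t ht] with ω hω hi
    rw [hω x (hi ▸ hD), hi]
  · have hx' : x ∈ P.ΓNeu i ∪ P.ΓRob i := by
      rw [← P.boundary_eq i] at hx
      rcases hx with (h | h) | h
      · exact absurd h hD
      · exact Or.inl h
      · exact Or.inr h
    obtain ⟨ε, hε, c, hc, hU, hb⟩ := hu.exists_normal_increment_bound ht hx'
    obtain ⟨b, hb'⟩ := hu.exists_bound_at (hU (-ε) ⟨le_rfl, by linarith⟩) ht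
    refine ⟨fun ω => b + c ω * |-ε|, (integrable_const b).add (hc.mul_const _), ?_⟩
    filter_upwards [hb, hb'] with ω h1 h2 hi
    have h3 := h1 hi (-ε) ⟨le_rfl, by linarith⟩
    have h4 := abs_sub_abs_le_abs_sub (u x t ω) (u (x + -ε • P.n x) t ω)
    linarith

/-- The weight is bounded and vanishes off `J t = i`, so `H` needs control only on that event. -/
theorem IsSolution.integrable_momentVar_mul [Finite I] [Nonempty I]
    (hu : IsSolution μ P J u) {M : ℕ} {i : I} {t : ℝ} (ht : 0 < t) {x : Fin M → E d}
    (hx : ∀ m, x m ∈ P.U) {H c : Ω → ℝ}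
    (hH : AEStronglyMeasurable (fun ω => momentVar J u i x t ω * H ω) μ)
    (hc : Integrable c μ) (hHc : ∀ᵐ ω ∂μ, J t ω = i → |H ω| ≤ c ω) :
    Integrable (fun ω => momentVar J u i x t ω * H ω) μ := by
  obtain ⟨B, hB⟩ := hu.exists_bound_momentVar i ht hx
  refine (hc.norm.const_mul |B|).mono' hH ?_
  filter_upwards [hB, hHc] with ω h1 h2
  rw [norm_mul]
  by_cases hi : J t ω = i
  · exact mul_le_mul (h1.trans (le_abs_self B)) ((h2 hi).trans (le_abs_self _)) (abs_nonneg _)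
      (abs_nonneg _)
  · have : momentVar J u i x t ω = 0 := momentVar_of_ne J u x hi
    rw [this, norm_zero, zero_mul]
    positivity

variable [Fintype I] [DecidableEq I] [IsProbabilityMeasure μ] {Q : Matrix I I ℝ}

theorem IsSolution.integrable_momentVar_mul_frontier (hJ : IsMarkovJumpProcess μ Q J)
    (hu : IsSolution μ P J u) {M : ℕ} {i : I} {t : ℝ} (ht : 0 < t) {x : Fin M → E d}
    (hx : ∀ m, x m ∈ P.U) {y : E d} (hy : y ∈ frontier P.U) :
    Integrable (fun ω => momentVar J u i x t ω * u y t ω) μ := by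
  have : Nonempty I := ⟨i⟩
  obtain ⟨c, hc, hc'⟩ := hu.exists_integrable_bound_frontier (i := i) ht hy
  exact hu.integrable_momentVar_mul ht hx
    ((hu.aestronglyMeasurable_momentVar hJ i ht fun m => subset_closure (hx m)).mul
      (hu.aestronglyMeasurable hJ ht (frontier_subset_closure hy))) hc hc'

/-- At Neumann and Robin points, the normal derivative commutes with the expectation. -/
theorem IsSolution.hasNormalDeriv_integral (hJ : IsMarkovJumpProcess μ Q J)
    (hu : IsSolution μ P J u) {M : ℕ} {i : I} {t : ℝ} (ht : 0 < t) {x : Fin M → E d}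
    (hx : ∀ m, x m ∈ P.U) {y : E d} (hy : y ∈ P.ΓNeu i ∪ P.ΓRob i) {D : Ω → ℝ}
    (hD : ∀ᵐ ω ∂μ, J t ω = i → HasNormalDeriv (fun y => u y t ω) y (P.n y) (D ω)) :
    Integrable (fun ω => momentVar J u i x t ω * D ω) μ ∧
      HasNormalDeriv (fun y => ∫ ω, momentVar J u i x t ω * u y t ω ∂μ) y (P.n y)
        (∫ ω, momentVar J u i x t ω * D ω ∂μ) := by
  have : Nonempty I := ⟨i⟩
  obtain ⟨ε, hε, c, hc, hU, hb⟩ := hu.exists_normal_increment_bound ht hy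
  set W := momentVar J u i x t with hW
  set q : ℝ → Ω → ℝ := fun r ω => r⁻¹ * (u (y + r • P.n y) t ω - u y t ω) with hq
  have hyf := P.frontier_of_mem hy
  have hWm : AEStronglyMeasurable W μ :=
    hu.aestronglyMeasurable_momentVar hJ i ht fun m => subset_closure (hx m)
  have hqm : ∀ r ∈ Ico (-ε) (0 : ℝ), AEStronglyMeasurable (q r) μ := fun r hr =>
    ((hu.aestronglyMeasurable hJ ht (subset_closure (hU r hr))).sub
      (hu.aestronglyMeasurable hJ ht (frontier_subset_closure hyf))).const_mul _
  have hqb : ∀ᵐ ω ∂μ, J t ω = i → ∀ r ∈ Ico (-ε) (0 : ℝ), |q r ω| ≤ c ω := by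
    filter_upwards [hb] with ω hω hi r hr
    have h1 : 0 < |r| := abs_pos.2 hr.2.ne
    rw [hq, abs_mul, abs_inv, inv_mul_le_iff₀ h1, abs_sub_comm, mul_comm]
    exact hω hi r ⟨hr.1, hr.2.le⟩
  have hlim : ∀ᵐ ω ∂μ, J t ω = i → Tendsto (fun r => q r ω) (𝓝[<] 0) (𝓝 (D ω)) := by
    filter_upwards [hD] with ω hω hi
    exact hasNormalDeriv_iff_tendsto.1 (hω hi)
  have hlimW : ∀ᵐ ω ∂μ, Tendsto (fun r => W ω * q r ω) (𝓝[<] 0) (𝓝 (W ω * D ω)) := by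
    filter_upwards [hlim] with ω hω
    by_cases hi : J t ω = i
    · exact (hω hi).const_mul _
    · have : W ω = 0 := momentVar_of_ne J u x hi
      simp [this]
  have hmem : Ico (-ε) (0 : ℝ) ∈ 𝓝[<] 0 := Ico_mem_nhdsLT (by linarith)
  have hDb : ∀ᵐ ω ∂μ, J t ω = i → |D ω| ≤ c ω := by
    filter_upwards [hlim, hqb] with ω h1 h2 hi
    refine le_of_tendsto (h1 hi).abs ?_
    filter_upwards [hmem] with r hr
    exact h2 hi r hr
  -- `D` is not assumed measurable; the product `W * D` is, as an almost sure limit of measurable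
  -- difference quotients.
  have hWD : AEStronglyMeasurable (fun ω => W ω * D ω) μ := by
    obtain ⟨r, -, hr, hr0⟩ := exists_seq_strictMono_tendsto' (show -ε < 0 by linarith)
    have hr0' : Tendsto r atTop (𝓝[<] 0) :=
      tendsto_nhdsWithin_iff.2 ⟨hr0, Eventually.of_forall fun n => (hr n).2⟩
    refine aestronglyMeasurable_of_tendsto_ae atTop (f := fun n ω => W ω * q (r n) ω)
      (fun n => hWm.mul (hqm _ ⟨(hr n).1.le, (hr n).2⟩)) ?_
    filter_upwards [hlimW] with ω hω
    exact hω.comp hr0'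
  refine ⟨hu.integrable_momentVar_mul ht hx hWD hc hDb, hasNormalDeriv_iff_tendsto.2 ?_⟩
  obtain ⟨B, hB⟩ := hu.exists_bound_momentVar i ht hx
  have hdom : Tendsto (fun r => ∫ ω, W ω * q r ω ∂μ) (𝓝[<] 0) (𝓝 (∫ ω, W ω * D ω ∂μ)) := by
    refine tendsto_integral_filter_of_dominated_convergence (fun ω => |B| * ‖c ω‖) ?_ ?_
      (hc.norm.const_mul _) hlimW
    · filter_upwards [hmem] with r hr
      exact hWm.mul (hqm r hr)
    · filter_upwards [hmem] with r hr
      filter_upwards [hB, hqb] with ω h1 h2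
      rw [norm_mul]
      by_cases hi : J t ω = i
      · exact mul_le_mul (h1.trans (le_abs_self B)) ((h2 hi r hr).trans (le_abs_self _))
          (abs_nonneg _) (abs_nonneg _)
      · have : W ω = 0 := momentVar_of_ne J u x hi
        rw [this, norm_zero, zero_mul]
        positivity
  refine hdom.congr' ?_
  filter_upwards [hmem] with r hr
  have hint : Integrable (fun ω => W ω * u (y + r • P.n y) t ω) μ := by
    obtain ⟨b, hb'⟩ := hu.exists_bound_at (hU r hr) ht
    exact hu.integrable_momentVar_mul ht hx
      (hWm.mul (hu.aestronglyMeasurable hJ ht (subset_closure (hU r hr))))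
      (integrable_const b) (hb'.mono fun ω hω _ => hω)
  rw [← integral_sub hint (hu.integrable_momentVar_mul_frontier hJ ht hx hyf),
    ← integral_const_mul]
  exact integral_congr_ae (Eventually.of_forall fun ω => by simp only [hq]; ring)

end Boundary

end SwitchingPDE

/-! ### Proof of the theorem -/

/-- The moment order is `M = n + 1`; the `m`-th operator acts on `y ↦ v (update x m y)`, and
`m.removeNth x` is the list of points with `x m` omitted. -/
theorem theorem2p1 {Ω I : Type*} [MeasurableSpace Ω] [Fintype I] [DecidableEq I] {d : ℕ}
    (μ : Measure Ω) [IsProbabilityMeasure μ] (Q : Matrix I I ℝ) (J : ℝ → Ω → I)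
    (hJ : SwitchingPDE.IsMarkovJumpProcess μ Q J)
    (P : SwitchingPDE.Data I d) (u : SwitchingPDE.E d → ℝ → Ω → ℝ)
    (hu : SwitchingPDE.IsSolution μ P J u) (n : ℕ) :
    -- the equation in the interior
    (∀ (i : I) (t : ℝ) (x : Fin (n + 1) → SwitchingPDE.E d), 0 < t → (∀ m, x m ∈ P.U) →
      Integrable (SwitchingPDE.momentVar J u i x t) μ ∧
      (∀ m, ContDiffOn ℝ 2 (fun y => SwitchingPDE.v μ J u i (Function.update x m y) t) P.U) ∧
      HasDerivAt (fun τ => SwitchingPDE.v μ J u i x τ)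
        (∑ m, P.L i (fun y => SwitchingPDE.v μ J u i (Function.update x m y) t) (x m)
          + ∑ j, Q j i * SwitchingPDE.v μ J u j x t) t) ∧
    -- the boundary conditions
    (∀ (i : I) (t : ℝ) (x : Fin (n + 1) → SwitchingPDE.E d) (m : Fin (n + 1)), 0 < t →
      x m ∈ frontier P.U → (∀ k, k ≠ m → x k ∈ P.U) →
      Integrable (SwitchingPDE.momentVar J u i x t) μ ∧
      (x m ∈ P.ΓDir i →
        SwitchingPDE.v μ J u i x t =
          P.gDir i (x m) * SwitchingPDE.v μ J u i (m.removeNth x) t) ∧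
      (x m ∈ P.ΓNeu i →
        SwitchingPDE.HasNormalDeriv
          (fun y => SwitchingPDE.v μ J u i (Function.update x m y) t) (x m) (P.n (x m))
          (P.gNeu i (x m) * SwitchingPDE.v μ J u i (m.removeNth x) t)) ∧
      (x m ∈ P.ΓRob i →
        Integrable (SwitchingPDE.momentVar J u i (Function.update x m (P.fRob i (x m))) t) μ ∧
        ∃ D, SwitchingPDE.HasNormalDeriv
            (fun y => SwitchingPDE.v μ J u i (Function.update x m y) t) (x m) (P.n (x m)) D ∧
          SwitchingPDE.v μ J u i (Function.update x m (P.fRob i (x m))) t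
              + P.hRob i (x m) * D =
            P.gRob i (x m) * SwitchingPDE.v μ J u i (m.removeNth x) t)) := by
  refine ⟨fun i t x ht hx => ?_, fun i t x m ht hxm hx => ?_⟩
  · have : Nonempty I := ⟨i⟩
    exact ⟨hu.integrable_momentVar hJ i ht hx, hu.contDiffOn_v hJ i ht hx,
      hu.hasDerivAt_v hJ i ht hx⟩
  have hx' : ∀ k, m.removeNth x k ∈ P.U := fun k => hx _ (Fin.succAbove_ne m k)
  have hmul := fun {y : SwitchingPDE.E d} (hy : y ∈ frontier P.U) =>
    hu.integrable_momentVar_mul_frontier (i := i) hJ ht hx' hy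
  have hup : ∀ y, SwitchingPDE.v μ J u i (Function.update x m y) t =
      ∫ ω, SwitchingPDE.momentVar J u i (m.removeNth x) t ω * u y t ω ∂μ := fun y =>
    integral_congr_ae (Eventually.of_forall fun ω => SwitchingPDE.momentVar_update J u i x m y t ω)
  refine ⟨?_, fun hD => ?_, fun hN => ?_, fun hR => ⟨?_, ?_⟩⟩
  · exact (hmul hxm).congr (Eventually.of_forall fun ω => (SwitchingPDE.momentVar_eq_mul J u i x m t ω).symm)
  · rw [SwitchingPDE.v, SwitchingPDE.v, ← integral_const_mul]
    refine integral_congr_ae ?_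
    filter_upwards [hu.dirichlet t ht] with ω hω
    rw [SwitchingPDE.momentVar_eq_mul J u i x m, mul_comm]
    by_cases hi : J t ω = i
    · rw [hω (x m) (hi ▸ hD), hi]
    · rw [SwitchingPDE.momentVar_of_ne J u _ hi, mul_zero, mul_zero]
  · have h := (hu.hasNormalDeriv_integral hJ ht hx' (D := fun _ => P.gNeu i (x m)) (Or.inl hN) (by
      filter_upwards [hu.neumann t ht] with ω hω hi
      have h1 := hω (x m) (hi ▸ hN)
      rwa [hi] at h1)).2
    rw [integral_mul_const, mul_comm] at h
    simp only [hup]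
    exact h
  · exact (hmul (P.fRob_mapsTo i hR)).congr
      (Eventually.of_forall fun ω => (SwitchingPDE.momentVar_update J u i x m _ t ω).symm)
  -- The random normal derivative is chosen path by path, with no measurability and an irrelevant
  -- value off `J t = i`, where the weight vanishes.
  · have hex : ∀ᵐ ω ∂μ, ∃ D, J t ω = i →
        SwitchingPDE.HasNormalDeriv (fun y => u y t ω) (x m) (P.n (x m)) D ∧
        u (P.fRob i (x m)) t ω + P.hRob i (x m) * D = P.gRob i (x m) := by
      filter_upwards [hu.robin t ht] with ω hω
      by_cases hi : J t ω = i
      · obtain ⟨D, h1, h2⟩ := hω (x m) (hi ▸ hR)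
        rw [hi] at h2
        exact ⟨D, fun _ => ⟨h1, h2⟩⟩
      · exact ⟨0, fun h => absurd h hi⟩
    obtain ⟨D, hD⟩ := hex.choice
    obtain ⟨h1, h2⟩ := hu.hasNormalDeriv_integral hJ ht hx' (D := D) (Or.inr hR)
      (hD.mono fun ω hω hi => (hω hi).1)
    simp only [hup]
    refine ⟨_, h2, ?_⟩
    rw [← integral_const_mul, ← integral_add (hmul (P.fRob_mapsTo i hR)) (h1.const_mul _), SwitchingPDE.v,
      ← integral_const_mul]
    refine integral_congr_ae ?_
    filter_upwards [hD] with ω hω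
    by_cases hi : J t ω = i
    · rw [← (hω hi).2]
      ring
    · simp [SwitchingPDE.momentVar_of_ne J u _ hi]
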